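/- Let $n\ge 3$. Let $D_n$ be the directed cycle on vertices $x_1,\dots,x_n$, with edges $(x_i,x_{i+1})$ for $1\le i\le n-1$ and $(x_n,x_1)$, all of weight $1$, and let the cycle network $G_n=(\{x_1,\dots,x_n\},\omega)$ be its shortest-distance digraph: the complete digraph in which $\omega(u,v)$ is the least weight (sum of edge weights) of a walk from $u$ to $v$ in $D_n$. For $\delta\in\mathbb R$ let - $\mathfrak D^{\mathrm{si}}_\delta$ be the Dowker sink complex, whose simplices are the nonempty vertex sets $\sigma$ such that some vertex $x'$ satisfies $\omega(x,x')\le\delta$ for all $x\in\sigma$; the Dowker source complex $\mathfrak D^{\mathrm{so}}_\delta$ is defined likewise with $\omega(x',x)\le\delta$; - $\mathfrak W_\delta$ be the walk-length complex, whose simplices are the nonempty vertex sets $\sigma$ for which the infimum of the weights of the walks in $G_n$ that contain all vertices of $\sigma$ is at most $\delta$. For a field $\mathbb K$ and $k\ge 0$, the $k$-dimensional persistence diagram of such a filtration is the multiset of pairs of endpoints $(p,q)\in\mathbb R\times(\mathbb R\cup\{\infty\})$ of the intervals in a decomposition of the persistence module $\{H_k(\,\cdot\,;\mathbb K)\}_{\delta\in\mathbb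 R}$ into a finite direct sum of interval modules. Then: 1. $\mathfrak D^{\mathrm{si}}_\delta=\mathfrak W_\delta$ for every $\delta\in\mathbb R$. 2. For every $k\ge 0$, the $k$-dimensional persistence diagrams of the Dowker filtrations (sink and source) and of the walk-length filtration of $G_n$ exist, are well defined (independent of the chosen decomposition), and are equal: $\mathrm{Dgm}^{\mathfrak D}_k(G_n)=\mathrm{Dgm}^{\mathrm{WL}}_k(G_n)$. 3. $\mathrm{Dgm}^{\mathrm{WL}}_1(G_n)=\{(1,\lceil n/2\rceil)\}$, a single point of multiplicity one. -/

import Mathlib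

set_option maxSynthPendingDepth 3

open CategoryTheory
open scoped NNReal

universe u

namespace WalkPersistence

noncomputable section

/-! ### Weighted digraphs, walks and networks -/

/-- A weighted directed graph with vertex set `V`: a set of directed edges, and a weight in `ℝ≥0`
for every edge, which is zero exactly on loops.  The value of `weight` at a pair that is not an
edge plays no role. -/
structure WeightedDigraph (V : Type) where
  Edge : V → V → Prop
  weight : V → V → ℝ≥0
  weight_eq_zero_iff : ∀ u v, Edge u v → (weight u v = 0 ↔ u = v)

/-- A network (complete weighted digraph): all pairs of vertices are edges. -/
structure Network (V : Type) where
  weight : V → V → ℝ≥0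
  weight_eq_zero_iff : ∀ u v, weight u v = 0 ↔ u = v

/-- A network as a weighted digraph. -/
def Network.toWeightedDigraph {V : Type} (X : Network V) : WeightedDigraph V where
  Edge _ _ := True
  weight := X.weight
  weight_eq_zero_iff u v _ := X.weight_eq_zero_iff u v

namespace WeightedDigraph

variable {V : Type}

/-- A walk `(v₀, …, v_m)`; vertices may be repeated. -/
structure Walk (D : WeightedDigraph V) where
  length : ℕ
  vertex : Fin (length + 1) → V
  edge : ∀ i : Fin length, D.Edge (vertex i.castSucc) (vertex i.succ)

/-- The weight of a walk: the sum of the weights of its edges. -/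
def Walk.weight {D : WeightedDigraph V} (γ : D.Walk) : ℝ≥0 :=
  ∑ i : Fin γ.length, D.weight (γ.vertex i.castSucc) (γ.vertex i.succ)

/-- `γ` starts at `u` and ends at `v`. -/
def Walk.Joins {D : WeightedDigraph V} (γ : D.Walk) (u v : V) : Prop :=
  γ.vertex 0 = u ∧ γ.vertex (Fin.last γ.length) = v

/-- Every ordered pair of vertices is joined by a walk. -/
def StronglyConnected (D : WeightedDigraph V) : Prop :=
  ∀ u v : V, ∃ γ : D.Walk, γ.Joins u v

/-- The shortest distance from `u` to `v`: the least weight of a walk from `u` to `v`.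
It is meant for strongly connected digraphs. -/
def shortestDistance (D : WeightedDigraph V) (u v : V) : ℝ≥0 :=
  sInf {r : ℝ≥0 | ∃ γ : D.Walk, γ.Joins u v ∧ γ.weight = r}

theorem shortestDistance_self (D : WeightedDigraph V) (u : V) : D.shortestDistance u u = 0 := by
  refine le_antisymm (csInf_le (OrderBot.bddBelow _) ?_) bot_le
  exact ⟨⟨0, fun _ => u, fun i => i.elim0⟩, ⟨rfl, rfl⟩, by simp [Walk.weight]⟩

/-- On a finite digraph a walk between distinct vertices has weight bounded away from `0`. -/
theorem shortestDistance_pos [Finite V] {D : WeightedDigraph V} (hD : D.StronglyConnected)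
    {u v : V} (huv : u ≠ v) : 0 < D.shortestDistance u v := by
  have hfin : (Set.range fun p : V × V => D.weight p.1 p.2).Finite := Set.finite_range _
  obtain ⟨c, hc, hmin⟩ : ∃ c : ℝ≥0, 0 < c ∧ ∀ a b : V, D.weight a b ≠ 0 → c ≤ D.weight a b := by
    by_cases hne : ((Set.range fun p : V × V => D.weight p.1 p.2) \ {0}).Nonempty
    · obtain ⟨c, ⟨_, hc0⟩, hle⟩ := Set.exists_min_image _ id (hfin.subset Set.sdiff_subset) hne
      exact ⟨c, pos_iff_ne_zero.mpr hc0, fun a b hab => hle _ ⟨⟨(a, b), rfl⟩, hab⟩⟩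
    · refine ⟨1, one_pos, fun a b hab => (hne ⟨_, ⟨(a, b), rfl⟩, hab⟩).elim⟩
  refine lt_of_lt_of_le hc (le_csInf ?_ ?_)
  · obtain ⟨γ, hγ⟩ := hD u v
    exact ⟨_, γ, hγ, rfl⟩
  · rintro r ⟨γ, ⟨h0, h1⟩, rfl⟩
    obtain ⟨i, hi⟩ : ∃ i : Fin γ.length, γ.vertex i.castSucc ≠ γ.vertex i.succ := by
      by_contra! hall
      have key : ∀ j : Fin (γ.length + 1), γ.vertex j = γ.vertex 0 := by
        intro j
        induction j using Fin.induction with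
        | zero => rfl
        | succ i ih => rw [← hall i, ih]
      exact huv (by rw [← h0, ← h1, key (Fin.last _)])
    have hne : D.weight (γ.vertex i.castSucc) (γ.vertex i.succ) ≠ 0 := fun h =>
      hi ((D.weight_eq_zero_iff _ _ (γ.edge i)).mp h)
    exact (hmin _ _ hne).trans (Finset.single_le_sum
      (f := fun i : Fin γ.length => D.weight (γ.vertex i.castSucc) (γ.vertex i.succ))
      (fun _ _ => bot_le) (Finset.mem_univ i))

/-- The shortest-distance digraph associated to a finite strongly connected weighted digraph. -/
def shortestDistanceNetwork [Finite V] (D : WeightedDigraph V) (hD : D.StronglyConnected) :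
    Network V where
  weight := D.shortestDistance
  weight_eq_zero_iff u v := by
    constructor
    · intro h
      by_contra huv
      exact (shortestDistance_pos hD huv).ne' h
    · rintro rfl
      exact D.shortestDistance_self u

end WeightedDigraph

/-! ### Cycle networks -/

/-- The directed cycle with vertices `0, …, n - 1` and an edge of weight `1` from each vertex to
the next one, cyclically. -/
def cycleDigraph (n : ℕ) (hn : 3 ≤ n) : WeightedDigraph (Fin n) where
  Edge i j := (j : ℕ) = ((i : ℕ) + 1) % n
  weight _ _ := 1
  weight_eq_zero_iff i j h := by
    simp only [one_ne_zero, false_iff]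
    rintro rfl
    have hi := i.isLt
    rcases Nat.lt_or_ge ((i : ℕ) + 1) n with h' | h'
    · rw [Nat.mod_eq_of_lt h'] at h
      omega
    · have : (i : ℕ) + 1 = n := by omega
      rw [this, Nat.mod_self] at h
      omega

theorem cycleDigraph_stronglyConnected (n : ℕ) (hn : 3 ≤ n) :
    (cycleDigraph n hn).StronglyConnected := by
  intro i j
  have hi := i.isLt
  have hj := j.isLt
  refine ⟨⟨n - i + j, fun k => ⟨((i : ℕ) + k) % n, Nat.mod_lt _ (by omega)⟩, ?_⟩, ?_, ?_⟩
  · intro k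
    simp [cycleDigraph, add_assoc]
  · ext
    simp [Nat.mod_eq_of_lt hi]
  · ext
    have : (i : ℕ) + (n - i + j) = n + j := by omega
    simp [this, Nat.mod_eq_of_lt hj]

/-- The cycle network `G_n`: the shortest-distance digraph of the directed `n`-cycle. -/
def cycleNetwork (n : ℕ) (hn : 3 ≤ n) : Network (Fin n) :=
  (cycleDigraph n hn).shortestDistanceNetwork (cycleDigraph_stronglyConnected n hn)

/-! ### Filtrations -/

/-- A filtration of simplicial complexes on the vertex set `V`, indexed by the real line. -/
abbrev Filtration (V : Type) := ℝ →o PreAbstractSimplicialComplex V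

/-- The Dowker sink filtration: `σ` is a simplex at `δ` if there is a vertex `x'` with
`ω(x, x') ≤ δ` for all `x ∈ σ`. -/
def dowkerSink {V : Type} (X : Network V) : Filtration V where
  toFun δ :=
    { faces := {σ | σ.Nonempty ∧ ∃ x' : V, ∀ x ∈ σ, (X.weight x x' : ℝ) ≤ δ}
      isRelLowerSet_faces := by
        rintro σ ⟨hσ, x', hx'⟩
        exact ⟨hσ, fun τ hτ hne => ⟨hne, x', fun x hx => hx' x (hτ hx)⟩⟩ }
  monotone' := by
    rintro δ δ' h σ ⟨hσ, x', hx'⟩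
    exact ⟨hσ, x', fun x hx => (hx' x hx).trans h⟩

/-- The Dowker source filtration: `σ` is a simplex at `δ` if there is a vertex `x'` with
`ω(x', x) ≤ δ` for all `x ∈ σ`. -/
def dowkerSource {V : Type} (X : Network V) : Filtration V where
  toFun δ :=
    { faces := {σ | σ.Nonempty ∧ ∃ x' : V, ∀ x ∈ σ, (X.weight x' x : ℝ) ≤ δ}
      isRelLowerSet_faces := by
        rintro σ ⟨hσ, x', hx'⟩
        exact ⟨hσ, fun τ hτ hne => ⟨hne, x', fun x hx => hx' x (hτ hx)⟩⟩ }
  monotone' := by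
    rintro δ δ' h σ ⟨hσ, x', hx'⟩
    exact ⟨hσ, x', fun x hx => (hx' x hx).trans h⟩

/-- `f_D(σ)`: the infimum of the weights of the walks that contain all vertices of `σ`
(it is `∞` if there is no such walk). -/
def walkLengthValue {V : Type} (D : WeightedDigraph V) (σ : Finset V) : EReal :=
  ⨅ (γ : D.Walk) (_ : ∀ x ∈ σ, x ∈ Set.range γ.vertex), ((γ.weight : ℝ) : EReal)

/-- The walk-length filtration: `σ` is a simplex at `δ` if `f_D(σ) ≤ δ`. -/
def walkLength {V : Type} (D : WeightedDigraph V) : Filtration V where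
  toFun δ :=
    { faces := {σ | σ.Nonempty ∧ walkLengthValue D σ ≤ (δ : EReal)}
      isRelLowerSet_faces := by
        rintro σ ⟨hσ, hf⟩
        refine ⟨hσ, fun τ hτ hne => ⟨hne, le_trans ?_ hf⟩⟩
        exact le_iInf₂ fun γ hγ => iInf₂_le γ fun x hx => hγ x (hτ hx) }
  monotone' := by
    rintro δ δ' h σ ⟨hσ, hf⟩
    exact ⟨hσ, hf.trans (EReal.coe_le_coe_iff.mpr h)⟩

/-! ### Simplicial homology

The total order on the vertices orients every simplex `[v₀ < ⋯ < v_k]`.  A chain is a finitely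
supported function on finite sets of vertices; a `k`-chain of a complex is supported on the
simplices of the complex with `k + 1` vertices. -/

section Homology

variable (K : Type u) [Field K] {V : Type}

/-- The boundary `∂[v₀, …, v_k] = ∑ i, (-1)^i [v₀, …, v̂ᵢ, …, v_k]` for `k ≥ 1`, and `∂[v₀] = 0`.
The index `i` of a vertex `v` is the number of vertices that precede it. -/
def boundary [LinearOrder V] : (Finset V →₀ K) →ₗ[K] (Finset V →₀ K) :=
  Finsupp.lsum K fun σ => LinearMap.toSpanSingleton K (Finset V →₀ K)
    (if 2 ≤ σ.card then
      ∑ v ∈ σ, Finsupp.single (σ.erase v) ((-1 : K) ^ (σ.filter (· < v)).card)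
    else 0)

/-- The `k`-chains of `X`. -/
def chains (X : PreAbstractSimplicialComplex V) (k : ℕ) : Submodule K (Finset V →₀ K) :=
  Finsupp.supported K K {σ | σ ∈ X ∧ σ.card = k + 1}

variable {K} in
theorem chains_mono {X Y : PreAbstractSimplicialComplex V} (h : X ≤ Y) (k : ℕ) :
    chains K X k ≤ chains K Y k :=
  Finsupp.supported_mono fun _ hσ => ⟨h hσ.1, hσ.2⟩

variable [LinearOrder V]

/-- The `k`-cycles of `X`: the kernel of `∂` on `k`-chains. -/
def cycles (X : PreAbstractSimplicialComplex V) (k : ℕ) : Submodule K (Finset V →₀ K) :=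
  chains K X k ⊓ LinearMap.ker (boundary K)

/-- The `k`-boundaries of `X`: the image of `∂` on `(k + 1)`-chains. -/
def boundaries (X : PreAbstractSimplicialComplex V) (k : ℕ) : Submodule K (Finset V →₀ K) :=
  (chains K X (k + 1)).map (boundary K)

variable {K} in
theorem cycles_mono {X Y : PreAbstractSimplicialComplex V} (h : X ≤ Y) (k : ℕ) :
    cycles K X k ≤ cycles K Y k :=
  inf_le_inf_right _ (chains_mono h k)

variable {K} in
theorem boundaries_mono {X Y : PreAbstractSimplicialComplex V} (h : X ≤ Y) (k : ℕ) :
    boundaries K X k ≤ boundaries K Y k :=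
  Submodule.map_mono (chains_mono h (k + 1))

/-- The `k`-th simplicial homology `H_k(X; K)`: cycles modulo boundaries. -/
abbrev homology (X : PreAbstractSimplicialComplex V) (k : ℕ) : Type u :=
  cycles K X k ⧸ (boundaries K X k).submoduleOf (cycles K X k)

/-- The map on homology induced by an inclusion of complexes. -/
def homologyMap {X Y : PreAbstractSimplicialComplex V} (h : X ≤ Y) (k : ℕ) :
    homology K X k →ₗ[K] homology K Y k :=
  Submodule.mapQ _ _ (Submodule.inclusion (cycles_mono h k)) fun _ hx => boundaries_mono h k hx

/-- The `k`-dimensional persistence module of a filtration. -/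
def persistentHomology (F : Filtration V) (k : ℕ) : ℝ ⥤ ModuleCat.{u} K where
  obj δ := ModuleCat.of K (homology K (F δ) k)
  map f := ModuleCat.ofHom (homologyMap K (F.monotone (leOfHom f)) k)
  map_id δ := by
    ext x
    rfl
  map_comp f g := by
    ext x
    rfl

end Homology

/-! ### Interval decompositions and persistence diagrams -/

/-- A nonempty interval of the real line with endpoints `birth ∈ ℝ` and `death ∈ ℝ ∪ {∞}`, each of
which may or may not belong to it. -/
structure Bar where
  birth : ℝ
  death : WithTop ℝ
  carrier : Set ℝ
  nonempty : carrier.Nonempty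
  mem_of_lt : ∀ t : ℝ, birth < t → (t : WithTop ℝ) < death → t ∈ carrier
  birth_le : ∀ t ∈ carrier, birth ≤ t
  le_death : ∀ t ∈ carrier, (t : WithTop ℝ) ≤ death

theorem Bar.mem_of_le_of_le (I : Bar) {r s t : ℝ} (hr : r ∈ I.carrier) (ht : t ∈ I.carrier)
    (hrs : r ≤ s) (hst : s ≤ t) : s ∈ I.carrier := by
  rcases hrs.eq_or_lt with rfl | h1
  · exact hr
  rcases hst.eq_or_lt with rfl | h2
  · exact ht
  exact I.mem_of_lt s ((I.birth_le r hr).trans_lt h1)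
    ((WithTop.coe_lt_coe.mpr h2).trans_le (I.le_death t ht))

section Interval

variable (K : Type u) [Field K]

open Classical in
/-- The space of an interval module at time `t`: `K` if `t` is in the interval, else `0`. -/
def intervalSpace (I : Bar) (t : ℝ) : Submodule K K :=
  if t ∈ I.carrier then ⊤ else ⊥

open Classical in
/-- The structure map of an interval module from `s` to `t`: the identity if both spaces are `K`,
and zero otherwise. -/
def intervalMap (I : Bar) (s t : ℝ) : intervalSpace K I s →ₗ[K] intervalSpace K I t :=
  LinearMap.codRestrict _ (if t ∈ I.carrier then (intervalSpace K I s).subtype else 0) fun c => by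
    unfold intervalSpace
    by_cases h : t ∈ I.carrier
    · rw [if_pos h]
      exact Submodule.mem_top
    · rw [if_neg h, if_neg h]
      exact Submodule.zero_mem _

/-- The interval module of `I`. -/
def intervalModule (I : Bar) : ℝ ⥤ ModuleCat.{u} K where
  obj t := ModuleCat.of K (intervalSpace K I t)
  map {s t} _ := ModuleCat.ofHom (intervalMap K I s t)
  map_id t := by
    ext ⟨c, hc⟩
    by_cases h : t ∈ I.carrier
    · simp [intervalMap, h]
    · have : c = 0 := by simpa [intervalSpace, h] using hc
      simp [intervalMap, h, this]
  map_comp {r s t} f g := by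
    ext ⟨c, hc⟩
    by_cases ht : t ∈ I.carrier
    · by_cases hs : s ∈ I.carrier
      · simp [intervalMap, hs, ht]
      · have hr : r ∉ I.carrier := fun hr =>
          hs (I.mem_of_le_of_le hr ht (leOfHom f) (leOfHom g))
        have : c = 0 := by simpa [intervalSpace, hr] using hc
        simp [intervalMap, hs, ht, this]
    · simp [intervalMap, ht]

/-- The direct sum of finitely many persistence modules, formed pointwise. -/
def directSum {m : ℕ} (M : Fin m → (ℝ ⥤ ModuleCat.{u} K)) : ℝ ⥤ ModuleCat.{u} K where
  obj t := ModuleCat.of K (∀ l : Fin m, (M l).obj t)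
  map f := ModuleCat.ofHom (LinearMap.pi fun l => ((M l).map f).hom ∘ₗ LinearMap.proj l)
  map_id t := by
    refine ModuleCat.hom_ext (LinearMap.ext fun x => funext fun l => ?_)
    simp
  map_comp f g := by
    refine ModuleCat.hom_ext (LinearMap.ext fun x => funext fun l => ?_)
    simp

variable {K}

/-- `M` is isomorphic to a finite direct sum of interval modules whose pairs of endpoints form the
multiset `D`. -/
def DecomposesAs (M : ℝ ⥤ ModuleCat.{u} K) (D : Multiset (ℝ × WithTop ℝ)) : Prop :=
  ∃ (m : ℕ) (B : Fin m → Bar),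
    Nonempty (M ≅ directSum K fun l => intervalModule K (B l)) ∧
    D = (Finset.univ : Finset (Fin m)).val.map fun l => ((B l).birth, (B l).death)

/-- `D` is the persistence diagram of `M`: the module `M` has an interval decomposition, and `D` is
the multiset of pairs of endpoints of every such decomposition. -/
def IsPersistenceDiagram (M : ℝ ⥤ ModuleCat.{u} K) (D : Multiset (ℝ × WithTop ℝ)) : Prop :=
  ∀ D' : Multiset (ℝ × WithTop ℝ), DecomposesAs M D' ↔ D' = D

end Interval

end

end WalkPersistence

namespace WalkPersistence

noncomputable section

/-! ### Decompositions from generators -/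

/-! All distances in `cycleNetwork` are whole numbers of steps, so at time `δ ≥ 0` each of the three
complexes consists of the nonempty sets lying on an arc of `⌊δ⌋₊` steps. The sink complex names the
end of the arc and the source complex its start. A walk of weight at most `δ` sweeps out such an arc
from its first vertex, and an arc is itself a walk by unit steps. So the three filtrations are
equal, not merely isomorphic in homology (`dowkerSink_eq_dowkerSource`,
`walkLength_eq_dowkerSource`).

The common filtration is empty at negative times and changes only at `0, …, n - 1`. Its homology is
therefore a finite-dimensional representation of a finite chain, from which intervals are split off
one at a time (`exists_interval_basis`, `exists_decomposesAs`). The diagram is unique because the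
rank of the map from `s` to `t` counts the bars containing both times, and these counts determine
the multiset of carriers (`DecomposesAs.unique`).

In degree one, chords inside an arc can be pushed onto the cycle, so every cycle is homologous to a
multiple of `fundamentalCycle`. That class exists from time `1` on. Once arcs reach half way round,
it is the sum of two paths joined by the same chord in opposite directions, hence a boundary. Before
that, the cochain `winding` vanishes on boundaries and is `-1` on the fundamental cycle. This leaves
the single bar `[1, ⌈n / 2⌉)`. -/

theorem mem_intervalSpace {K : Type u} [Field K] {I : Bar} {t : ℝ} {c : K} :
    c ∈ intervalSpace K I t ↔ (t ∉ I.carrier → c = 0) := by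
  by_cases h : t ∈ I.carrier <;> simp [intervalSpace, h]

theorem intervalMap_apply_of_mem {K : Type u} [Field K] {I : Bar} {s t : ℝ} (ht : t ∈ I.carrier)
    (c : intervalSpace K I s) : (intervalMap K I s t c : K) = c := by
  simp [intervalMap, ht]

theorem intervalMap_apply_of_notMem {K : Type u} [Field K] {I : Bar} {s t : ℝ}
    (ht : t ∉ I.carrier) (c : intervalSpace K I s) : (intervalMap K I s t c : K) = 0 := by
  simp [intervalMap, ht]

/-- The comparison map from a sum of interval spaces given by a family of vectors. -/
def generatorMap {K : Type u} [Field K] (M : ℝ ⥤ ModuleCat.{u} K) {m : ℕ} (B : Fin m → Bar)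
    (t : ℝ) (v : Fin m → M.obj t) : (∀ l, intervalSpace K (B l) t) →ₗ[K] M.obj t :=
  ∑ l, ((intervalSpace K (B l) t).subtype ∘ₗ LinearMap.proj l).smulRight (v l)

theorem generatorMap_apply {K : Type u} [Field K] (M : ℝ ⥤ ModuleCat.{u} K) {m : ℕ}
    (B : Fin m → Bar) (t : ℝ) (v : Fin m → M.obj t) (c : ∀ l, intervalSpace K (B l) t) :
    generatorMap M B t v c = ∑ l, (c l : K) • v l := by
  simp [generatorMap]

/-- A persistence module with vectors `v l t` that, at every time `t`, form a basis when `l` runs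
over the bars alive at `t`, and that are compatible with the structure maps, is the direct sum of
the interval modules of the bars. -/
theorem decomposesAs_of_generators {K : Type u} [Field K] (M : ℝ ⥤ ModuleCat.{u} K) {m : ℕ}
    (B : Fin m → Bar) (v : Fin m → ∀ t, M.obj t)
    (hzero : ∀ l t, t ∉ (B l).carrier → v l t = 0)
    (hmap : ∀ l s t (h : s ≤ t), s ∈ (B l).carrier → (M.map (homOfLE h)).hom (v l s) = v l t)
    (hspan : ∀ t (x : M.obj t), ∃ c : Fin m → K, ∑ l, c l • v l t = x)
    (hinj : ∀ t (c : Fin m → K), (∀ l, t ∉ (B l).carrier → c l = 0) →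
      ∑ l, c l • v l t = 0 → ∀ l, c l = 0) :
    DecomposesAs M ((Finset.univ : Finset (Fin m)).val.map
      fun l => ((B l).birth, (B l).death)) := by
  classical
  have hbij : ∀ t, Function.Bijective (generatorMap M B t fun l => v l t) := by
    intro t
    constructor
    · rw [← LinearMap.ker_eq_bot, LinearMap.ker_eq_bot']
      intro c hc
      rw [generatorMap_apply] at hc
      have := hinj t (fun l => (c l : K)) (fun l => mem_intervalSpace.mp (c l).2) hc
      exact funext fun l => Subtype.ext (this l)
    · intro x
      obtain ⟨c, hc⟩ := hspan t x
      -- Coefficients at dead bars may be cut to zero, since the generators vanish there.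
      refine ⟨fun l => ⟨if t ∈ (B l).carrier then c l else 0, mem_intervalSpace.mpr fun h => ?_⟩, ?_⟩
      · simp [h]
      · rw [generatorMap_apply, ← hc]
        refine Finset.sum_congr rfl fun l _ => ?_
        by_cases h : t ∈ (B l).carrier
        · simp [h]
        · simp [h, hzero l t h]
  refine ⟨m, B, ⟨Iso.symm (NatIso.ofComponents
    (fun t => (LinearEquiv.ofBijective _ (hbij t)).toModuleIso) ?_)⟩, rfl⟩
  intro s t f
  suffices h : ∀ c : (∀ l, intervalSpace K (B l) s),
      generatorMap M B t (fun l => v l t) (fun l => intervalMap K (B l) s t (c l)) =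
        (M.map f).hom (generatorMap M B s (fun l => v l s) c) from
    ModuleCat.hom_ext (LinearMap.ext h)
  intro c
  rw [generatorMap_apply, generatorMap_apply, map_sum]
  refine Finset.sum_congr rfl fun l _ => ?_
  rw [map_smul]
  by_cases hs : s ∈ (B l).carrier
  · have := hmap l s t (leOfHom f) hs
    rw [show homOfLE (leOfHom f) = f from rfl] at this
    rw [this]
    by_cases ht : t ∈ (B l).carrier
    · rw [intervalMap_apply_of_mem ht]
    · simp [hzero l t ht]
  · have h0 : ((c l : intervalSpace K (B l) s) : K) = 0 := mem_intervalSpace.mp (c l).2 hs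
    by_cases ht : t ∈ (B l).carrier
    · rw [intervalMap_apply_of_mem ht, h0, zero_smul, zero_smul]
    · rw [intervalMap_apply_of_notMem ht, h0, zero_smul, zero_smul]

/-! ### Uniqueness of interval decompositions -/

/-- The fields `birth` and `death` are forced to be the infimum and supremum of the nonempty
carrier. Both inequalities below express this, and together they show that the carrier determines
the endpoints. -/
theorem Bar.birth_le_of_carrier_subset {I J : Bar} (h : J.carrier ⊆ I.carrier) :
    I.birth ≤ J.birth := by
  by_contra! hlt
  obtain ⟨t, ht⟩ := J.nonempty
  have hIt := I.birth_le t (h ht)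
  obtain ⟨s, hs1, hs2⟩ := exists_between hlt
  have hs : s ∈ J.carrier := J.mem_of_lt s hs1
    ((WithTop.coe_lt_coe.mpr (hs2.trans_le hIt)).trans_le (J.le_death t ht))
  exact (I.birth_le s (h hs)).not_gt hs2

theorem Bar.death_le_of_carrier_subset {I J : Bar} (h : J.carrier ⊆ I.carrier) :
    J.death ≤ I.death := by
  by_contra! hlt
  obtain ⟨t, ht⟩ := J.nonempty
  obtain ⟨d, hd⟩ := WithTop.ne_top_iff_exists.mp hlt.ne_top
  rw [← hd] at hlt
  obtain ⟨s, hs1, hs2⟩ : ∃ s : ℝ, d < s ∧ (s : WithTop ℝ) < J.death := by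
    rcases eq_or_ne J.death ⊤ with h' | h'
    · exact ⟨d + 1, by linarith, h' ▸ WithTop.coe_lt_top _⟩
    · obtain ⟨e, he⟩ := WithTop.ne_top_iff_exists.mp h'
      rw [← he] at hlt ⊢
      obtain ⟨s, h1, h2⟩ := exists_between (WithTop.coe_lt_coe.mp hlt)
      exact ⟨s, h1, WithTop.coe_lt_coe.mpr h2⟩
  have htd : t ≤ d := WithTop.coe_le_coe.mp (hd ▸ I.le_death t (h ht))
  have hs : s ∈ J.carrier := J.mem_of_lt s ((J.birth_le t ht).trans_lt (htd.trans_lt hs1)) hs2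
  exact (WithTop.coe_le_coe.mp (hd ▸ I.le_death s (h hs))).not_gt hs1

theorem Bar.endpoints_eq_of_carrier_eq {I J : Bar} (h : I.carrier = J.carrier) :
    (I.birth, I.death) = (J.birth, J.death) :=
  Prod.ext (le_antisymm (birth_le_of_carrier_subset h.ge) (birth_le_of_carrier_subset h.le))
    (le_antisymm (death_le_of_carrier_subset h.le) (death_le_of_carrier_subset h.ge))

/-- The structure map of a sum of interval modules. -/
def sumIntervalMap (K : Type u) [Field K] {m : ℕ} (B : Fin m → Bar) (s t : ℝ) :
    (∀ l, intervalSpace K (B l) s) →ₗ[K] (∀ l, intervalSpace K (B l) t) :=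
  LinearMap.pi fun l => intervalMap K (B l) s t ∘ₗ LinearMap.proj l

theorem sumIntervalMap_apply {K : Type u} [Field K] {m : ℕ} (B : Fin m → Bar) {s t : ℝ}
    (c : ∀ l, intervalSpace K (B l) s) (l : Fin m) :
    sumIntervalMap K B s t c l = intervalMap K (B l) s t (c l) := rfl

open Classical in
/-- The rank of the structure map of a sum of interval modules is the number of intervals that
contain both times. -/
theorem finrank_range_sumIntervalMap {K : Type u} [Field K] {m : ℕ} (B : Fin m → Bar)
    (s t : ℝ) :
    Module.finrank K (LinearMap.range (sumIntervalMap K B s t)) =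
      Fintype.card {l : Fin m // s ∈ (B l).carrier ∧ t ∈ (B l).carrier} := by
  let A := {l : Fin m // s ∈ (B l).carrier ∧ t ∈ (B l).carrier}
  -- Extension by zero from the bars containing both times: it is injective and has the same range
  -- as the structure map, which gives the rank.
  let g : (A → K) →ₗ[K] (∀ l, intervalSpace K (B l) t) := LinearMap.pi fun l =>
    if h : s ∈ (B l).carrier ∧ t ∈ (B l).carrier then
      LinearMap.codRestrict _ (LinearMap.proj (⟨l, h⟩ : A))
        (fun c => mem_intervalSpace.mpr fun h' => (h' h.2).elim) else 0
  have hg1 : ∀ (c : A → K) (l : A), (g c l.1 : K) = c l := by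
    intro c l
    simp [g, l.2]
  have hg0 : ∀ (c : A → K) (l : Fin m), ¬ (s ∈ (B l).carrier ∧ t ∈ (B l).carrier) →
      g c l = 0 := by
    intro c l hl
    simp only [g, LinearMap.pi_apply, dif_neg hl, LinearMap.zero_apply]
  have hginj : Function.Injective g := fun c c' h => funext fun l => by
    rw [← hg1 c, ← hg1 c', h]
  have hrange : LinearMap.range (sumIntervalMap K B s t) = LinearMap.range g := by
    apply le_antisymm
    · rintro _ ⟨c, rfl⟩
      refine ⟨fun l => (c l.1 : intervalSpace K (B l.1) s), funext fun l => Subtype.ext ?_⟩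
      rw [sumIntervalMap_apply]
      by_cases h : s ∈ (B l).carrier ∧ t ∈ (B l).carrier
      · rw [hg1 _ ⟨l, h⟩, intervalMap_apply_of_mem h.2]
      · rw [hg0 _ l h]
        by_cases ht : t ∈ (B l).carrier
        · rw [intervalMap_apply_of_mem ht]
          exact (mem_intervalSpace.mp (c l).2 fun hs => h ⟨hs, ht⟩).symm
        · rw [intervalMap_apply_of_notMem ht]
          rfl
    · rintro _ ⟨c, rfl⟩
      refine ⟨fun l => ⟨if h : s ∈ (B l).carrier ∧ t ∈ (B l).carrier then c ⟨l, h⟩ else 0,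
        mem_intervalSpace.mpr fun hs => dif_neg fun h => hs h.1⟩, funext fun l => Subtype.ext ?_⟩
      rw [sumIntervalMap_apply]
      by_cases h : s ∈ (B l).carrier ∧ t ∈ (B l).carrier
      · rw [hg1 _ ⟨l, h⟩, intervalMap_apply_of_mem h.2]
        exact dif_pos h
      · rw [hg0 _ l h]
        by_cases ht : t ∈ (B l).carrier
        · rw [intervalMap_apply_of_mem ht]
          exact dif_neg h
        · rw [intervalMap_apply_of_notMem ht]
          rfl
  rw [hrange, LinearMap.finrank_range_of_inj hginj, Module.finrank_fintype_fun_eq_card]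

/-- Isomorphic persistence modules have structure maps of the same rank. -/
theorem finrank_range_map_eq_of_iso {K : Type u} [Field K] {M N : ℝ ⥤ ModuleCat.{u} K}
    (e : M ≅ N) {s t : ℝ} (f : s ⟶ t) :
    Module.finrank K (LinearMap.range (M.map f).hom) =
      Module.finrank K (LinearMap.range (N.map f).hom) := by
  let es := (e.app s).toLinearEquiv
  let et := (e.app t).toLinearEquiv
  have h : et.toLinearMap ∘ₗ (M.map f).hom = (N.map f).hom ∘ₗ es.toLinearMap :=
    congrArg ModuleCat.Hom.hom (e.hom.naturality f)
  have h1 : (LinearMap.range (M.map f).hom).map et.toLinearMap = LinearMap.range (N.map f).hom := by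
    rw [← LinearMap.range_comp, h, LinearMap.range_comp_of_range_eq_top _ es.range]
  rw [← h1]
  exact (et.finrank_map_eq _).symm

open Classical in
/-- Two finite multisets in a partial order with equally many elements above every point
coincide. -/
theorem multiset_eq_of_card_filter_ge_eq {α : Type*} [PartialOrder α] {A B : Multiset α}
    (h : ∀ a, a ∈ A ∨ a ∈ B → (A.filter (a ≤ ·)).card = (B.filter (a ≤ ·)).card) : A = B := by
  by_contra hne
  let S : Finset α := (A.toFinset ∪ B.toFinset).filter fun a => A.count a ≠ B.count a
  have hS : S.Nonempty := by
    by_contra hS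
    apply hne
    ext a
    by_contra ha
    refine hS ⟨a, Finset.mem_filter.mpr ⟨?_, ha⟩⟩
    rw [Finset.mem_union, Multiset.mem_toFinset, Multiset.mem_toFinset]
    by_contra! h'
    rw [Multiset.count_eq_zero_of_notMem h'.1, Multiset.count_eq_zero_of_notMem h'.2] at ha
    exact ha rfl
  -- At a maximal point of disagreement the multisets agree strictly above, so the counts of
  -- elements `≥ a` differ by exactly the difference of multiplicities at `a`.
  obtain ⟨a, haS, hmax⟩ := S.exists_maximal hS
  have haS' := Finset.mem_filter.mp haS
  have hab : a ∈ A ∨ a ∈ B := by simpa using haS'.1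
  have hcard := h a hab
  have key : ∀ C : Multiset α, (C.filter (a ≤ ·)).card =
      C.count a + (C.filter (a < ·)).card := by
    intro C
    rw [Multiset.count_eq_card_filter_eq, ← Multiset.card_add]
    congr 1
    ext b
    simp only [Multiset.count_add, Multiset.count_filter]
    rcases eq_or_ne a b with rfl | hb
    · simp
    · simp [hb, lt_iff_le_and_ne]
  have hgt : A.filter (a < ·) = B.filter (a < ·) := by
    ext b
    rw [Multiset.count_filter, Multiset.count_filter]
    split_ifs with hb
    · by_contra hcb
      have hbS : b ∈ S := by
        refine Finset.mem_filter.mpr ⟨?_, hcb⟩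
        rw [Finset.mem_union, Multiset.mem_toFinset, Multiset.mem_toFinset]
        by_contra! h'
        rw [Multiset.count_eq_zero_of_notMem h'.1, Multiset.count_eq_zero_of_notMem h'.2] at hcb
        exact hcb rfl
      exact (hmax hbS hb.le).not_gt hb
    · rfl
  rw [key, key, hgt] at hcard
  exact haS'.2 (by omega)

/-- Finitely many bars are separated from the subintervals of `I` by two points of `I`. -/
theorem Bar.exists_test_points (I : Bar) (T : Finset (Set ℝ)) :
    ∃ s ∈ I.carrier, ∃ t ∈ I.carrier, s ≤ t ∧
      ∀ J : Bar, J.carrier ∈ T → s ∈ J.carrier → t ∈ J.carrier → I.carrier ⊆ J.carrier := by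
  classical
  induction T using Finset.induction_on with
  | empty =>
    obtain ⟨s, hs⟩ := I.nonempty
    exact ⟨s, hs, s, hs, le_rfl, by simp⟩
  | insert U T _ ih =>
    obtain ⟨s, hs, t, ht, hst, h⟩ := ih
    by_cases hU : I.carrier ⊆ U
    · refine ⟨s, hs, t, ht, hst, fun J hJ hsJ htJ => ?_⟩
      rcases Finset.mem_insert.mp hJ with rfl | hJ
      · exact hU
      · exact h J hJ hsJ htJ
    -- Stretching the test interval to include `p` excludes `U`: a bar containing both new test
    -- points would contain `p` by convexity.
    · obtain ⟨p, hp, hpU⟩ := Set.not_subset.mp hU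
      have hmin : min s p ∈ I.carrier := by
        rcases min_choice s p with h' | h' <;> rw [h'] <;> assumption
      have hmax : max t p ∈ I.carrier := by
        rcases max_choice t p with h' | h' <;> rw [h'] <;> assumption
      refine ⟨min s p, hmin, max t p, hmax, (min_le_left _ _).trans (hst.trans (le_max_left _ _)),
        fun J hJ hsJ htJ => ?_⟩
      rcases Finset.mem_insert.mp hJ with rfl | hJ
      · exact (hpU (J.mem_of_le_of_le hsJ htJ (min_le_right _ _) (le_max_right _ _))).elim
      · exact h J hJ
          (J.mem_of_le_of_le hsJ htJ (min_le_left _ _) (hst.trans (le_max_left _ _)))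
          (J.mem_of_le_of_le hsJ htJ ((min_le_left _ _).trans hst) (le_max_left _ _))

/-- The endpoints of the bars in an interval decomposition depend only on the module. -/
theorem DecomposesAs.unique {K : Type u} [Field K] {M : ℝ ⥤ ModuleCat.{u} K}
    {D D' : Multiset (ℝ × WithTop ℝ)} (h : DecomposesAs M D) (h' : DecomposesAs M D') :
    D = D' := by
  classical
  obtain ⟨m, B, ⟨e⟩, rfl⟩ := h
  obtain ⟨m', B', ⟨e'⟩, rfl⟩ := h'
  have hrank : ∀ s t : ℝ, s ≤ t →
      Fintype.card {l : Fin m // s ∈ (B l).carrier ∧ t ∈ (B l).carrier} =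
      Fintype.card {l : Fin m' // s ∈ (B' l).carrier ∧ t ∈ (B' l).carrier} := by
    intro s t hst
    rw [← finrank_range_sumIntervalMap (K := K) B s t, ← finrank_range_sumIntervalMap (K := K) B']
    exact finrank_range_map_eq_of_iso (e.symm ≪≫ e') (homOfLE hst)
  let A := (Finset.univ : Finset (Fin m)).val.map fun l => (B l).carrier
  let A' := (Finset.univ : Finset (Fin m')).val.map fun l => (B' l).carrier
  -- At test points adapted to `I`, the bars containing both are exactly those containing `I`, so
  -- the rank counts bars above `I` in the inclusion order.
  have hcount : ∀ I : Bar, (A.filter (I.carrier ≤ ·)).card = (A'.filter (I.carrier ≤ ·)).card := by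
    intro I
    obtain ⟨s, hs, t, ht, hst, hI⟩ := I.exists_test_points (A.toFinset ∪ A'.toFinset)
    have hr := hrank s t hst
    rw [Fintype.card_subtype, Fintype.card_subtype] at hr
    have h1 : ∀ l, (I.carrier ≤ (B l).carrier) ↔ (s ∈ (B l).carrier ∧ t ∈ (B l).carrier) :=
      fun l => ⟨fun h => ⟨h hs, h ht⟩, fun h => hI (B l) (by simp [A]) h.1 h.2⟩
    have h2 : ∀ l, (I.carrier ≤ (B' l).carrier) ↔ (s ∈ (B' l).carrier ∧ t ∈ (B' l).carrier) :=
      fun l => ⟨fun h => ⟨h hs, h ht⟩, fun h => hI (B' l) (by simp [A']) h.1 h.2⟩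
    simp only [A, A', Multiset.filter_map, Multiset.card_map, Function.comp_def, h1, h2]
    exact hr
  have hAA' : A = A' := by
    apply multiset_eq_of_card_filter_ge_eq
    rintro _ (ha | ha)
    · obtain ⟨l, -, rfl⟩ := Multiset.mem_map.mp ha
      exact hcount _
    · obtain ⟨l, -, rfl⟩ := Multiset.mem_map.mp ha
      exact hcount _
  -- Reads endpoints off a carrier; the value `(0, 0)` on other sets plays no role.
  let ends : Set ℝ → ℝ × WithTop ℝ := fun S =>
    if h : ∃ J : Bar, J.carrier = S then (h.choose.birth, h.choose.death) else (0, 0)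
  have hends : ∀ J : Bar, ends J.carrier = (J.birth, J.death) := by
    intro J
    have h : ∃ J' : Bar, J'.carrier = J.carrier := ⟨J, rfl⟩
    simp only [ends, dif_pos h]
    exact Bar.endpoints_eq_of_carrier_eq h.choose_spec
  have := congrArg (Multiset.map ends) hAA'
  simpa only [A, A', Multiset.map_map, Function.comp_def, hends] using this

theorem DecomposesAs.isPersistenceDiagram {K : Type u} [Field K] {M : ℝ ⥤ ModuleCat.{u} K}
    {D : Multiset (ℝ × WithTop ℝ)} (h : DecomposesAs M D) : IsPersistenceDiagram M D :=
  fun _ => ⟨fun h' => h'.unique h, fun h' => h' ▸ h⟩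

/-! ### Existence of interval decompositions -/

/-- Every subrepresentation `W` of a representation of the poset `{0, …, N}` by finite-dimensional
vector spaces is a sum of intervals: the `l`-th one lives on `{a l, …, b l}` and is generated by
the vectors `v l k`. -/
theorem exists_interval_basis {K : Type*} [Field K] {V : ℕ → Type*} [∀ i, AddCommGroup (V i)]
    [∀ i, Module K (V i)] [∀ i, FiniteDimensional K (V i)]
    (f : ∀ i j, i ≤ j → V i →ₗ[K] V j) (fid : ∀ i x, f i i le_rfl x = x)
    (fcomp : ∀ i j k (hij : i ≤ j) (hjk : j ≤ k) x,
      f j k hjk (f i j hij x) = f i k (hij.trans hjk) x) (N : ℕ)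
    (W : ∀ i, Submodule K (V i)) (hW : ∀ i j h, W i ≤ (W j).comap (f i j h)) :
    ∃ (m : ℕ) (a b : Fin m → ℕ) (v : Fin m → ∀ k, V k),
      (∀ l, a l ≤ b l ∧ b l ≤ N) ∧
      (∀ l k, ¬ (a l ≤ k ∧ k ≤ b l) → v l k = 0) ∧
      (∀ l s t h, t ≤ N → a l ≤ s → s ≤ b l → f s t h (v l s) = v l t) ∧
      (∀ l k, k ≤ N → v l k ∈ W k) ∧
      (∀ k, k ≤ N → ∀ x ∈ W k, ∃ c : Fin m → K, ∑ l, c l • v l k = x) ∧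
      (∀ k, k ≤ N → ∀ c : Fin m → K, (∀ l, ¬ (a l ≤ k ∧ k ≤ b l) → c l = 0) →
        ∑ l, c l • v l k = 0 → ∀ l, c l = 0) := by
  classical
  -- Induction on the total dimension: each pass splits one interval off `W`, and the complement is
  -- again a subrepresentation of the same `V`.
  induction hd : ∑ i ∈ Finset.range (N + 1), Module.finrank K (W i) using Nat.strong_induction_on
    generalizing W with
  | _ d ih =>
  by_cases hbot : ∀ i ≤ N, W i = ⊥
  · refine ⟨0, Fin.elim0, Fin.elim0, fun l => l.elim0, fun l => l.elim0, fun l => l.elim0,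
      fun l => l.elim0, fun l => l.elim0, fun k hk x hx => ⟨fun _ => 0, ?_⟩,
      fun _ _ _ _ _ l => l.elim0⟩
    rw [hbot k hk, Submodule.mem_bot] at hx
    simp [hx]
  have hex : ∃ i, i ≤ N ∧ W i ≠ ⊥ := by
    push Not at hbot
    exact hbot
  -- Starting at the earliest nonzero time ensures that no vector of `W` before the new interval has
  -- to be accounted for.
  obtain ⟨i, ⟨hiN, hi⟩, hmin⟩ : ∃ i, (i ≤ N ∧ W i ≠ ⊥) ∧ ∀ k < i, ¬ (k ≤ N ∧ W k ≠ ⊥) :=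
    ⟨Nat.find hex, Nat.find_spec hex, fun k hk => Nat.find_min hex hk⟩
  obtain ⟨w, hw, hw0⟩ := (Submodule.ne_bot_iff _).mp hi
  let P : ℕ → Prop := fun j => ∃ h : i ≤ j, f i j h w ≠ 0
  have hPi : P i := ⟨le_rfl, by rwa [fid]⟩
  obtain ⟨j, hjN, ⟨hij, hj⟩, hjmax⟩ : ∃ j ≤ N, P j ∧ ∀ k, j < k → k ≤ N → ¬ P k :=
    ⟨Nat.findGreatest P N, Nat.findGreatest_le N, Nat.findGreatest_spec hiN hPi,
      fun k h1 h2 => Nat.findGreatest_is_greatest h1 h2⟩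
  obtain ⟨lam, hlam⟩ : ∃ lam : V j →ₗ[K] K, lam (f i j hij w) = 1 :=
    Module.Projective.exists_dual_eq_one K hj
  -- The functional `lam`, equal to `1` on the last nonzero image of `w`, is pulled back to all
  -- times up to `j`. Its kernels are stable under the maps and complement the line of `w` on `{i,
  -- …, j}`; after `j` that line is zero and no condition is imposed.
  let W' : ∀ k, Submodule K (V k) := fun k =>
    if h : k ≤ j then W k ⊓ LinearMap.ker (lam ∘ₗ f k j h) else W k
  have hW'mem : ∀ k x, x ∈ W' k ↔ x ∈ W k ∧ ∀ h : k ≤ j, lam (f k j h x) = 0 := by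
    intro k x
    by_cases h : k ≤ j <;> simp [W', h]
  have hW'le : ∀ k, W' k ≤ W k := fun k x hx => ((hW'mem k x).mp hx).1
  have hW' : ∀ s t h, W' s ≤ (W' t).comap (f s t h) := by
    intro s t h x hx
    rw [Submodule.mem_comap, hW'mem]
    obtain ⟨h1, h2⟩ := (hW'mem s x).mp hx
    exact ⟨hW s t h h1, fun htj => by rw [fcomp]; exact h2 _⟩
  have hlt : ∑ k ∈ Finset.range (N + 1), Module.finrank K (W' k) < d := by
    rw [← hd]
    refine Finset.sum_lt_sum (fun k _ => Submodule.finrank_mono (hW'le k))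
      ⟨i, Finset.mem_range.mpr (by omega), Submodule.finrank_lt_finrank_of_lt ?_⟩
    refine lt_of_le_of_ne (hW'le i) fun h => ?_
    have := ((hW'mem i w).mp (h ▸ hw)).2 hij
    rw [hlam] at this
    exact one_ne_zero this
  obtain ⟨m, a, b, v, hab, hz, hmp, hmem, hspan, hinj⟩ := ih _ hlt W' hW' rfl
  let v₀ : ∀ k, V k := fun k => if h : i ≤ k ∧ k ≤ j then f i k h.1 w else 0
  have hv₀ : ∀ k (h1 : i ≤ k), k ≤ j → v₀ k = f i k h1 w := fun k h1 h2 => dif_pos ⟨h1, h2⟩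
  have hv₀' : ∀ k, ¬ (i ≤ k ∧ k ≤ j) → v₀ k = 0 := fun k h => dif_neg h
  have hv₀W : ∀ k, v₀ k ∈ W k := by
    intro k
    by_cases h : i ≤ k ∧ k ≤ j
    · rw [hv₀ k h.1 h.2]
      exact hW i k h.1 hw
    · rw [hv₀' k h]
      exact zero_mem _
  have hlamv₀ : ∀ k (_ : i ≤ k) (h2 : k ≤ j), lam (f k j h2 (v₀ k)) = 1 := by
    intro k h1 h2
    rw [hv₀ k h1 h2, fcomp, hlam]
  refine ⟨m + 1, Fin.cons i a, Fin.cons j b, Fin.cons v₀ v, ?_, ?_, ?_, ?_, ?_, ?_⟩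
  · exact Fin.cases ⟨hij, hjN⟩ hab
  · exact Fin.cases hv₀' hz
  · refine Fin.cases ?_ hmp
    intro s t h htN his hsj
    simp only [Fin.cons_zero] at his hsj ⊢
    rw [hv₀ s his hsj, fcomp]
    by_cases htj : t ≤ j
    · rw [hv₀ t (his.trans h) htj]
    · rw [hv₀' t fun h' => htj h'.2]
      by_contra hne
      exact hjmax t (by omega) htN ⟨his.trans h, hne⟩
  · exact Fin.cases (fun k _ => hv₀W k) fun l k hk => hW'le k (hmem l k hk)
  · intro k hk x hx
    by_cases hki : k < i
    · have hWk : W k = ⊥ := by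
        by_contra h
        exact hmin k hki ⟨hk, h⟩
      rw [hWk, Submodule.mem_bot] at hx
      exact ⟨fun _ => 0, by simp [hx]⟩
    by_cases hkj : k ≤ j
    · have hx' : x - lam (f k j hkj x) • v₀ k ∈ W' k := by
        refine (hW'mem k _).mpr ⟨sub_mem hx ((W k).smul_mem _ (hv₀W k)), fun _ => ?_⟩
        rw [map_sub, map_smul, map_sub, map_smul, hlamv₀ k (by omega) hkj]
        simp
      obtain ⟨c, hc⟩ := hspan k hk _ hx'
      refine ⟨Fin.cons (lam (f k j hkj x)) c, ?_⟩
      simp [Fin.sum_univ_succ, hc]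
    · obtain ⟨c, hc⟩ := hspan k hk x ((hW'mem k x).mpr ⟨hx, fun h => (hkj h).elim⟩)
      refine ⟨Fin.cons 0 c, ?_⟩
      simp [Fin.sum_univ_succ, hc]
  · intro k hk c hc hsum
    rw [Fin.sum_univ_succ] at hsum
    simp only [Fin.cons_zero, Fin.cons_succ] at hsum
    -- Applying `lam` at time `j` kills the generators from `W'` and sends `v₀` to `1`.
    have hc0 : c 0 = 0 := by
      by_cases h : i ≤ k ∧ k ≤ j
      · have h1 := congrArg (fun x => lam (f k j h.2 x)) hsum
        simp only [map_add, map_smul, map_sum, map_zero, hlamv₀ k h.1 h.2] at h1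
        rw [Finset.sum_eq_zero fun l _ => by
          rw [((hW'mem k _).mp (hmem l k hk)).2 h.2, smul_zero]] at h1
        simpa using h1
      · exact hc 0 h
    rw [hc0, zero_smul, zero_add] at hsum
    have := hinj k hk (fun l => c l.succ) (fun l hl => hc l.succ hl) hsum
    exact Fin.cases hc0 this

/-- The bar `[a, b + 1)`, or `[a, ∞)` if `b` is the last time `N`. -/
def stepBar (N a b : ℕ) (hab : a ≤ b) : Bar where
  birth := a
  death := if b < N then ((b + 1 : ℝ) : WithTop ℝ) else ⊤
  carrier := {t | (a : ℝ) ≤ t ∧ (b < N → t < b + 1)}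
  nonempty := ⟨a, le_rfl, fun _ => by
    have : (a : ℝ) ≤ b := Nat.cast_le.mpr hab
    linarith⟩
  mem_of_lt t h1 h2 := ⟨h1.le, fun h => by
    rw [if_pos h] at h2
    exact WithTop.coe_lt_coe.mp h2⟩
  birth_le _ h := h.1
  le_death t h := by
    split_ifs with hb
    · exact WithTop.coe_le_coe.mpr (h.2 hb).le
    · exact le_top

/-- The last time in `{0, …, N}` up to `t`. -/
def stepTime (N : ℕ) (t : ℝ) : ℕ := min ⌊t⌋₊ N

theorem stepTime_le (N : ℕ) {t : ℝ} (ht : 0 ≤ t) : (stepTime N t : ℝ) ≤ t :=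
  (Nat.cast_le.mpr (min_le_left _ _)).trans (Nat.floor_le ht)

theorem stepTime_mono (N : ℕ) {s t : ℝ} (h : s ≤ t) : stepTime N s ≤ stepTime N t :=
  min_le_min_right _ (Nat.floor_le_floor h)

/-- For `b = N` the bound `stepTime N t ≤ b` is automatic, in agreement with the infinite bar. The
condition `0 ≤ t` is separate because `stepTime` is `0` at negative times. -/
theorem mem_stepBar_carrier {N a b : ℕ} (hab : a ≤ b) (hb : b ≤ N) {t : ℝ} :
    t ∈ (stepBar N a b hab).carrier ↔ 0 ≤ t ∧ a ≤ stepTime N t ∧ stepTime N t ≤ b := by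
  change (a : ℝ) ≤ t ∧ (b < N → t < b + 1) ↔ _
  rcases lt_or_ge t 0 with ht | ht
  · have : ¬ (a : ℝ) ≤ t := fun h => (ht.trans_le (Nat.cast_nonneg a)).not_ge h
    simp [this, ht]
  · rw [← Nat.le_floor_iff ht, show (t < (b : ℝ) + 1) ↔ ⌊t⌋₊ < b + 1 by
      rw [Nat.floor_lt ht]; push_cast; rfl]
    unfold stepTime
    simp only [ht, true_and]
    omega

/-- A persistence module that vanishes at negative times, is finite dimensional, and changes only
at the times `0, …, N`, has an interval decomposition. -/
theorem exists_decomposesAs {K : Type u} [Field K] (M : ℝ ⥤ ModuleCat.{u} K) (N : ℕ)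
    (hfin : ∀ i : ℕ, FiniteDimensional K (M.obj (i : ℝ)))
    (hneg : ∀ t : ℝ, t < 0 → Subsingleton (M.obj t))
    (hbij : ∀ (t : ℝ) (ht : 0 ≤ t), Function.Bijective (M.map (homOfLE (stepTime_le N ht))).hom) :
    ∃ D, DecomposesAs M D := by
  have hcomp : ∀ (r s t : ℝ) (hrs : r ≤ s) (hst : s ≤ t) (x : M.obj r),
      (M.map (homOfLE hst)).hom ((M.map (homOfLE hrs)).hom x) =
        (M.map (homOfLE (hrs.trans hst))).hom x := by
    intro r s t hrs hst x
    rw [← homOfLE_comp hrs hst, M.map_comp]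
    rfl
  obtain ⟨m, a, b, v, hab, hz, hmp, -, hspan, hinj⟩ := exists_interval_basis (K := K)
    (V := fun i : ℕ => M.obj (i : ℝ))
    (fun i j h => (M.map (homOfLE (Nat.cast_le.mpr h))).hom)
    (fun i x => by simp)
    (fun i j k hij hjk x => hcomp _ _ _ _ _ x) N (fun _ => ⊤) (fun _ _ _ _ _ => trivial)
  -- Generators are carried from the last step time up to `t`, and set to zero at negative times,
  -- where the module vanishes.
  let v' : Fin m → ∀ t, M.obj t := fun l t =>
    if h : 0 ≤ t then (M.map (homOfLE (stepTime_le N h))).hom (v l (stepTime N t)) else 0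
  have hv' : ∀ l t (h : 0 ≤ t),
      v' l t = (M.map (homOfLE (stepTime_le N h))).hom (v l (stepTime N t)) :=
    fun l t h => dif_pos h
  refine ⟨_, decomposesAs_of_generators M (fun l => stepBar N (a l) (b l) (hab l).1) v'
    ?_ ?_ ?_ ?_⟩
  · intro l t ht
    rw [mem_stepBar_carrier _ (hab l).2] at ht
    by_cases h : 0 ≤ t
    · rw [hv' l t h, hz l _ fun h' => ht ⟨h, h'⟩, map_zero]
    · exact dif_neg h
  · intro l s t h hs
    obtain ⟨hs0, hs1, hs2⟩ := (mem_stepBar_carrier _ (hab l).2).mp hs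
    rw [hv' l s hs0, hv' l t (hs0.trans h), hcomp,
      ← hmp l _ _ (stepTime_mono N h) (min_le_right _ _) hs1 hs2, hcomp]
  · intro t x
    by_cases ht : 0 ≤ t
    · obtain ⟨y, rfl⟩ := (hbij t ht).2 x
      obtain ⟨c, rfl⟩ := hspan (stepTime N t) (min_le_right _ _) y trivial
      exact ⟨c, by simp only [hv' _ t ht, map_sum, map_smul]⟩
    · have := hneg t (not_le.mp ht)
      exact ⟨0, Subsingleton.elim _ _⟩
  · intro t c hc hsum
    by_cases ht : 0 ≤ t
    · refine hinj (stepTime N t) (min_le_right _ _) c (fun l hl => hc l fun h => hl ?_) ?_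
      · exact ((mem_stepBar_carrier _ (hab l).2).mp h).2
      · apply (hbij t ht).1
        simpa only [hv' _ t ht, map_sum, map_smul, map_zero] using hsum
    · exact fun l => hc l fun h => ht ((mem_stepBar_carrier _ (hab l).2).mp h).1

/-! ### The filtrations of the cycle networks -/

open scoped Fin.CommRing in
/-- A walk in the directed cycle moves on by one vertex in every step. -/
theorem cycleDigraph_walk_vertex {n : ℕ} (hn : 3 ≤ n) [NeZero n] (γ : (cycleDigraph n hn).Walk)
    (k : Fin (γ.length + 1)) : γ.vertex k = γ.vertex 0 + ((k : ℕ) : Fin n) := by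
  induction k using Fin.induction with
  | zero => simp
  | succ i ih =>
    have h : (γ.vertex i.succ : ℕ) = ((γ.vertex i.castSucc : ℕ) + 1) % n := γ.edge i
    have h' : γ.vertex i.succ = γ.vertex i.castSucc + 1 := by
      ext
      rw [h, Fin.val_add, Fin.val_one', Nat.add_mod_mod]
    rw [h', ih]
    simp [add_assoc]

theorem cycleDigraph_walk_weight {n : ℕ} (hn : 3 ≤ n) (γ : (cycleDigraph n hn).Walk) :
    γ.weight = γ.length := by
  simp [WeightedDigraph.Walk.weight, cycleDigraph]

open scoped Fin.CommRing in
/-- The weights of the cycle network: the number of steps from `i` to `j`. -/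
theorem cycleNetwork_weight {n : ℕ} (hn : 3 ≤ n) [NeZero n] (i j : Fin n) :
    ∃ d : ℕ, (cycleNetwork n hn).weight i j = d ∧ j = i + (d : Fin n) ∧
      ∀ e : ℕ, j = i + (e : Fin n) → d ≤ e := by
  classical
  have hex : ∃ d : ℕ, j = i + (d : Fin n) := ⟨((j - i : Fin n) : ℕ), by simp⟩
  -- A walk of length `e` from `i` ends at `i + e`, so the distance is the least natural number
  -- representing `j - i` modulo `n`.
  refine ⟨Nat.find hex, le_antisymm (csInf_le (OrderBot.bddBelow _) ?_) (le_csInf ?_ ?_),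
    Nat.find_spec hex, fun e he => Nat.find_min' hex he⟩
  · refine ⟨⟨Nat.find hex, fun k => i + ((k : ℕ) : Fin n), fun k => ?_⟩, ⟨?_, ?_⟩, ?_⟩
    · change ((i + ((k.succ : ℕ) : Fin n) : Fin n) : ℕ) =
        ((i + ((k.castSucc : ℕ) : Fin n) : Fin n) + 1) % n
      rw [Fin.val_succ, Nat.cast_succ, ← add_assoc, Fin.val_add, Fin.val_one', Nat.add_mod_mod]
      rfl
    · simp
    · exact (Nat.find_spec hex).symm
    · rw [cycleDigraph_walk_weight]
  · obtain ⟨γ, hγ⟩ := cycleDigraph_stronglyConnected n hn i j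
    exact ⟨_, γ, hγ, rfl⟩
  · rintro _ ⟨γ, ⟨h0, h1⟩, rfl⟩
    rw [cycleDigraph_walk_weight]
    refine Nat.cast_le.mpr (Nat.find_min' hex ?_)
    rw [← h1, cycleDigraph_walk_vertex, h0]
    rfl

open scoped Fin.CommRing in
-- Any step count `d` is allowed as a witness, not only the least one, so that arcs can be shifted
-- and added without reducing modulo `n`.
theorem cycleNetwork_weight_le_iff {n : ℕ} (hn : 3 ≤ n) [NeZero n] (i j : Fin n) (δ : ℝ) :
    ((cycleNetwork n hn).weight i j : ℝ) ≤ δ ↔ ∃ d : ℕ, (d : ℝ) ≤ δ ∧ j = i + (d : Fin n) := by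
  obtain ⟨d, hd, hj, hmin⟩ := cycleNetwork_weight hn i j
  rw [hd]
  constructor
  · intro h
    exact ⟨d, by simpa using h, hj⟩
  · rintro ⟨e, he, hje⟩
    refine le_trans ?_ he
    simpa using hmin e hje

open scoped Fin.CommRing in
theorem mem_dowkerSource_cycleNetwork {n : ℕ} (hn : 3 ≤ n) [NeZero n] (δ : ℝ)
    (σ : Finset (Fin n)) :
    σ ∈ dowkerSource (cycleNetwork n hn) δ ↔ σ.Nonempty ∧
      ∃ x : Fin n, ∀ v ∈ σ, ∃ d : ℕ, (d : ℝ) ≤ δ ∧ v = x + (d : Fin n) := by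
  simp only [← cycleNetwork_weight_le_iff hn]
  rfl

open scoped Fin.CommRing in
theorem mem_dowkerSink_cycleNetwork {n : ℕ} (hn : 3 ≤ n) [NeZero n] (δ : ℝ)
    (σ : Finset (Fin n)) :
    σ ∈ dowkerSink (cycleNetwork n hn) δ ↔ σ.Nonempty ∧
      ∃ x : Fin n, ∀ v ∈ σ, ∃ d : ℕ, (d : ℝ) ≤ δ ∧ x = v + (d : Fin n) := by
  simp only [← cycleNetwork_weight_le_iff hn]
  rfl

open scoped Fin.CommRing in
/-- The Dowker complexes of a cycle network consist of the sets contained in short arcs. -/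
theorem dowkerSink_eq_dowkerSource {n : ℕ} (hn : 3 ≤ n) :
    dowkerSink (cycleNetwork n hn) = dowkerSource (cycleNetwork n hn) := by
  have : NeZero n := ⟨by omega⟩
  refine OrderHom.ext _ _ (funext fun δ => SetLike.ext fun σ => ?_)
  rw [mem_dowkerSource_cycleNetwork, mem_dowkerSink_cycleNetwork]
  refine and_congr_right fun ⟨w, hw⟩ => ?_
  constructor
  · rintro ⟨x, hx⟩
    obtain ⟨d₀, hd₀, -⟩ := hx w hw
    have hδ : 0 ≤ δ := (Nat.cast_nonneg _).trans hd₀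
    -- The arc of `⌊δ⌋₊` steps that ends at `x` starts here.
    refine ⟨x - (⌊δ⌋₊ : Fin n), fun v hv => ?_⟩
    obtain ⟨d, hd, rfl⟩ := hx v hv
    have hd' : d ≤ ⌊δ⌋₊ := Nat.le_floor hd
    refine ⟨⌊δ⌋₊ - d, (Nat.cast_le.mpr (Nat.sub_le _ _)).trans (Nat.floor_le hδ), ?_⟩
    rw [Nat.cast_sub hd']
    ring
  · rintro ⟨x, hx⟩
    obtain ⟨d₀, hd₀, -⟩ := hx w hw
    have hδ : 0 ≤ δ := (Nat.cast_nonneg _).trans hd₀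
    refine ⟨x + (⌊δ⌋₊ : Fin n), fun v hv => ?_⟩
    obtain ⟨d, hd, rfl⟩ := hx v hv
    have hd' : d ≤ ⌊δ⌋₊ := Nat.le_floor hd
    refine ⟨⌊δ⌋₊ - d, (Nat.cast_le.mpr (Nat.sub_le _ _)).trans (Nat.floor_le hδ), ?_⟩
    rw [Nat.cast_sub hd']
    ring

/-- The total number of steps of a walk in a cycle network. -/
theorem exists_steps_of_walk {n : ℕ} (hn : 3 ≤ n)
    (γ : (cycleNetwork n hn).toWeightedDigraph.Walk) : ∃ d : ℕ, γ.weight = d := by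
  have : NeZero n := ⟨by omega⟩
  choose s hs _ using fun i j => cycleNetwork_weight hn i j
  exact ⟨∑ i : Fin γ.length, s (γ.vertex i.castSucc) (γ.vertex i.succ), by
    simp [WeightedDigraph.Walk.weight, Network.toWeightedDigraph, hs]⟩

open scoped Fin.CommRing in
/-- The vertices of a walk of weight at most `δ` lie on the arc of length `δ` from its start. -/
theorem exists_le_of_walk {n : ℕ} (hn : 3 ≤ n) [NeZero n]
    (γ : (cycleNetwork n hn).toWeightedDigraph.Walk) (k : Fin (γ.length + 1)) :
    ∃ d : ℕ, (d : ℝ) ≤ γ.weight ∧ γ.vertex k = γ.vertex 0 + (d : Fin n) := by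
  choose s hs hs' _ using fun i j => cycleNetwork_weight hn i j
  let step : Fin γ.length → ℕ := fun i => s (γ.vertex i.castSucc) (γ.vertex i.succ)
  have hweight : (γ.weight : ℝ) = ((∑ i, step i : ℕ) : ℝ) := by
    simp [WeightedDigraph.Walk.weight, Network.toWeightedDigraph, hs, step]
  -- The steps taken before position `k`, not reduced modulo `n`, so that they are a partial sum of
  -- the weight.
  refine ⟨∑ i with i.castSucc < k, step i, ?_, ?_⟩
  · rw [hweight]
    exact Nat.cast_le.mpr (Finset.sum_le_sum_of_subset (Finset.filter_subset _ _))
  · induction k using Fin.induction with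
    | zero => simp
    | succ i ih =>
      have hins : (Finset.univ.filter fun l : Fin γ.length => l.castSucc < i.succ) =
          insert i (Finset.univ.filter fun l : Fin γ.length => l.castSucc < i.castSucc) := by
        ext l
        simp only [Finset.mem_filter, Finset.mem_univ, true_and, Finset.mem_insert, Fin.lt_def,
          Fin.ext_iff, Fin.val_castSucc, Fin.val_succ]
        omega
      rw [hins, Finset.sum_insert (by simp), add_comm (step i), Nat.cast_add, ← add_assoc, ← ih]
      exact hs' (γ.vertex i.castSucc) (γ.vertex i.succ)

open scoped Fin.CommRing in
theorem walkLength_eq_dowkerSource {n : ℕ} (hn : 3 ≤ n) :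
    walkLength (cycleNetwork n hn).toWeightedDigraph = dowkerSource (cycleNetwork n hn) := by
  have : NeZero n := ⟨by omega⟩
  refine OrderHom.ext _ _ (funext fun δ => SetLike.ext fun σ => ?_)
  rw [mem_dowkerSource_cycleNetwork]
  change (σ.Nonempty ∧ walkLengthValue _ σ ≤ (δ : EReal)) ↔ _
  refine and_congr_right fun ⟨w, hw⟩ => ?_
  constructor
  · intro h
    -- The infimum need not be known to be attained: some walk weighs less than `⌊δ⌋ + 1`, and an
    -- integral weight below that bound is at most `δ`.
    have hlt : walkLengthValue (cycleNetwork n hn).toWeightedDigraph σ <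
        (((⌊δ⌋ + 1 : ℤ) : ℝ) : EReal) :=
      h.trans_lt (EReal.coe_lt_coe_iff.mpr (by push_cast; exact Int.lt_floor_add_one δ))
    simp only [walkLengthValue, iInf_lt_iff] at hlt
    obtain ⟨γ, hγ, hlt⟩ := hlt
    rw [EReal.coe_lt_coe_iff] at hlt
    obtain ⟨q, hq⟩ := exists_steps_of_walk hn γ
    have hqδ : (γ.weight : ℝ) ≤ δ := by
      rw [hq] at hlt ⊢
      have h1 : (q : ℤ) < ⌊δ⌋ + 1 := by
        have : ((q : ℤ) : ℝ) < ((⌊δ⌋ + 1 : ℤ) : ℝ) := by simpa using hlt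
        exact_mod_cast this
      have h2 : ((q : ℤ) : ℝ) ≤ δ := Int.le_floor.mp (Int.lt_add_one_iff.mp h1)
      simpa using h2
    refine ⟨γ.vertex 0, fun v hv => ?_⟩
    obtain ⟨k, rfl⟩ := hγ v hv
    obtain ⟨d, hd, hk⟩ := exists_le_of_walk hn γ k
    exact ⟨d, hd.trans hqδ, hk⟩
  · rintro ⟨x, hx⟩
    obtain ⟨d₀, hd₀, -⟩ := hx w hw
    have hδ : 0 ≤ δ := (Nat.cast_nonneg _).trans hd₀
    -- The arc itself, traversed by steps of weight at most `1`.
    let γ : (cycleNetwork n hn).toWeightedDigraph.Walk :=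
      ⟨⌊δ⌋₊, fun k => x + ((k : ℕ) : Fin n), fun _ => trivial⟩
    refine (iInf₂_le γ fun v hv => ?_).trans (EReal.coe_le_coe_iff.mpr ?_)
    · obtain ⟨d, hd, rfl⟩ := hx v hv
      exact ⟨⟨d, Nat.lt_succ_of_le (Nat.le_floor hd)⟩, rfl⟩
    · refine le_trans ?_ (Nat.floor_le hδ)
      have : γ.weight ≤ ∑ _i : Fin ⌊δ⌋₊, 1 := by
        refine Finset.sum_le_sum fun i _ => ?_
        have := (cycleNetwork_weight_le_iff hn (γ.vertex i.castSucc) (γ.vertex i.succ) 1).mpr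
          ⟨1, by simp, by simp [γ, add_assoc]⟩
        exact_mod_cast this
      have h2 : (γ.weight : ℝ) ≤ ((∑ _i : Fin ⌊δ⌋₊, 1 : ℝ≥0) : ℝ) := by exact_mod_cast this
      simpa using h2

open scoped Fin.CommRing in
theorem mem_dowkerSource_iff_floor {n : ℕ} (hn : 3 ≤ n) [NeZero n] {δ : ℝ} (hδ : 0 ≤ δ)
    (σ : Finset (Fin n)) :
    σ ∈ dowkerSource (cycleNetwork n hn) δ ↔ σ.Nonempty ∧
      ∃ x : Fin n, ∀ v ∈ σ, ∃ d : ℕ, d ≤ ⌊δ⌋₊ ∧ v = x + (d : Fin n) := by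
  simp only [mem_dowkerSource_cycleNetwork, Nat.le_floor_iff hδ]

theorem notMem_dowkerSource_of_neg {V : Type} (X : Network V) {δ : ℝ} (hδ : δ < 0)
    (σ : Finset V) : σ ∉ dowkerSource X δ := by
  rintro ⟨⟨v, hv⟩, x, hx⟩
  exact (hδ.trans_le (NNReal.coe_nonneg _)).not_ge (hx v hv)

open scoped Fin.CommRing in
/-- The Dowker filtration of a cycle network changes only at the times `0, …, n - 1`. -/
theorem dowkerSource_stepTime {n : ℕ} (hn : 3 ≤ n) {δ : ℝ} (hδ : 0 ≤ δ) :
    dowkerSource (cycleNetwork n hn) (stepTime (n - 1) δ) =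
      dowkerSource (cycleNetwork n hn) δ := by
  have : NeZero n := ⟨by omega⟩
  refine SetLike.ext fun σ => ?_
  rw [mem_dowkerSource_iff_floor hn hδ, mem_dowkerSource_iff_floor hn (Nat.cast_nonneg _),
    Nat.floor_natCast]
  rcases le_total ⌊δ⌋₊ (n - 1) with h | h
  · rw [stepTime, min_eq_left h]
  · rw [stepTime, min_eq_right h]
    refine and_congr_right fun _ => exists_congr fun x => forall₂_congr fun v _ => ?_
    -- An arc of `n - 1` steps already contains every vertex.
    have hd : ((v - x : Fin n) : ℕ) ≤ n - 1 := by
      have := (v - x).isLt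
      omega
    have hv : v = x + (((v - x : Fin n) : ℕ) : Fin n) := by simp
    exact ⟨fun _ => ⟨_, hd.trans h, hv⟩, fun _ => ⟨_, hd, hv⟩⟩

/-! ### Persistent homology has an interval decomposition -/

theorem homologyMap_bijective_of_eq {K : Type u} [Field K] {V : Type} [LinearOrder V]
    {X Y : PreAbstractSimplicialComplex V} (hXY : X ≤ Y) (heq : X = Y) (k : ℕ) :
    Function.Bijective (homologyMap K hXY k) := by
  subst heq
  have : homologyMap K hXY k = LinearMap.id := by
    ext x
    rfl
  rw [this]
  exact Function.bijective_id

theorem homology_subsingleton_of_cycles_le {K : Type u} [Field K] {V : Type} [LinearOrder V]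
    {X : PreAbstractSimplicialComplex V} {k : ℕ} (h : cycles K X k ≤ boundaries K X k) :
    Subsingleton (homology K X k) := by
  refine Submodule.Quotient.subsingleton_iff.mpr (top_le_iff.mp fun x _ => ?_)
  exact h x.2

theorem cycles_eq_bot {K : Type u} [Field K] {V : Type} [LinearOrder V]
    {X : PreAbstractSimplicialComplex V} {k : ℕ} (h : ∀ σ ∈ X, σ.card ≠ k + 1) :
    cycles K X k = ⊥ := by
  have : {σ : Finset V | σ ∈ X ∧ σ.card = k + 1} = ∅ :=
    Set.eq_empty_iff_forall_notMem.mpr fun σ hσ => h σ hσ.1 hσ.2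
  rw [cycles, chains, this, Finsupp.supported_empty, bot_inf_eq]

theorem exists_decomposesAs_dowkerSource {n : ℕ} (hn : 3 ≤ n) (K : Type u) [Field K] (k : ℕ) :
    ∃ D, DecomposesAs (persistentHomology K (dowkerSource (cycleNetwork n hn)) k) D := by
  refine exists_decomposesAs _ (n - 1) (fun i => ?_) (fun t ht => ?_) fun t ht => ?_
  · change FiniteDimensional K (homology K _ k)
    infer_instance
  · refine homology_subsingleton_of_cycles_le (K := K) ?_
    rw [cycles_eq_bot fun σ hσ => (notMem_dowkerSource_of_neg _ ht σ hσ).elim]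
    exact bot_le
  · exact homologyMap_bijective_of_eq
      ((dowkerSource _).monotone (stepTime_le _ ht)) (dowkerSource_stepTime hn ht) k

/-! ### Oriented edges -/

section OrientedEdges

variable {V : Type} [LinearOrder V]

theorem boundary_single (K : Type u) [Field K] (σ : Finset V) :
    boundary K (Finsupp.single σ (1 : K)) = if 2 ≤ σ.card then
      ∑ v ∈ σ, Finsupp.single (σ.erase v) ((-1 : K) ^ (σ.filter (· < v)).card) else 0 := by
  simp [boundary]

theorem boundary_single_pair (K : Type u) [Field K] {a b : V} (hab : a < b) :
    boundary K (Finsupp.single {a, b} (1 : K)) =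
      Finsupp.single {b} 1 - Finsupp.single {a} 1 := by
  have e1 : ({a, b} : Finset V).erase a = {b} := by ext x; simp; grind
  have e2 : ({a, b} : Finset V).erase b = {a} := by ext x; simp; grind
  rw [boundary_single, if_pos (by rw [Finset.card_pair hab.ne]), Finset.sum_pair hab.ne, e1, e2]
  have h1 : ({a, b} : Finset V).filter (· < a) = ∅ := by ext x; simp; grind
  have h2 : ({a, b} : Finset V).filter (· < b) = {a} := by ext x; simp; grind
  rw [h1, h2]
  simp [sub_eq_add_neg]

theorem boundary_single_triple (K : Type u) [Field K] {a b c : V} (hab : a < b) (hbc : b < c) :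
    boundary K (Finsupp.single {a, b, c} (1 : K)) =
      Finsupp.single {b, c} 1 - Finsupp.single {a, c} 1 + Finsupp.single {a, b} 1 := by
  have hac := hab.trans hbc
  have e1 : ({a, b, c} : Finset V).erase a = {b, c} := by ext x; simp; grind
  have e2 : ({a, b, c} : Finset V).erase b = {a, c} := by ext x; simp; grind
  have e3 : ({a, b, c} : Finset V).erase c = {a, b} := by ext x; simp; grind
  have h1 : ({a, b, c} : Finset V).filter (· < a) = ∅ := by ext x; simp; grind
  have h2 : ({a, b, c} : Finset V).filter (· < b) = {a} := by ext x; simp; grind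
  have h3 : ({a, b, c} : Finset V).filter (· < c) = {a, b} := by ext x; simp; grind
  have hcard : ({a, b, c} : Finset V).card = 3 :=
    Finset.card_eq_three.mpr ⟨a, b, c, hab.ne, hac.ne, hbc.ne, rfl⟩
  rw [boundary_single, if_pos (by omega), Finset.sum_insert (by simp [hab.ne, hac.ne]),
    Finset.sum_pair hbc.ne, e1, e2, e3, h1, h2, h3, Finset.card_pair hab.ne]
  simp only [Finset.card_empty, pow_zero, Finset.card_singleton, pow_one, Finsupp.single_neg]
  norm_num
  abel

/-- The edge from `u` to `v` as a chain; it is `0` if `u = v`. -/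
def orientedEdge (K : Type u) [Field K] (u v : V) : Finset V →₀ K :=
  if u < v then Finsupp.single {u, v} 1 else if v < u then -Finsupp.single {v, u} 1 else 0

theorem orientedEdge_of_lt (K : Type u) [Field K] {u v : V} (h : u < v) :
    orientedEdge K u v = Finsupp.single {u, v} 1 := if_pos h

theorem orientedEdge_self (K : Type u) [Field K] (u : V) : orientedEdge K u u = 0 := by
  simp [orientedEdge]

theorem orientedEdge_swap (K : Type u) [Field K] (u v : V) :
    orientedEdge K v u = -orientedEdge K u v := by
  rcases lt_trichotomy u v with h | rfl | h
  · simp [orientedEdge, h, h.not_gt]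
  · simp [orientedEdge]
  · simp [orientedEdge, h, h.not_gt]

theorem boundary_orientedEdge (K : Type u) [Field K] (u v : V) :
    boundary K (orientedEdge K u v) = Finsupp.single {v} 1 - Finsupp.single {u} 1 := by
  rcases lt_trichotomy u v with h | rfl | h
  · rw [orientedEdge_of_lt K h, boundary_single_pair K h]
  · simp [orientedEdge]
  · rw [orientedEdge_swap, orientedEdge_of_lt K h, map_neg, boundary_single_pair K h, neg_sub]

theorem orientedEdge_mem_chains {K : Type u} [Field K] {X : PreAbstractSimplicialComplex V}
    {u v : V} (h : {u, v} ∈ X) : orientedEdge K u v ∈ chains K X 1 := by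
  rcases lt_trichotomy u v with huv | rfl | huv
  · rw [orientedEdge_of_lt K huv]
    exact Finsupp.single_mem_supported K 1 ⟨h, Finset.card_pair huv.ne⟩
  · rw [orientedEdge_self]
    exact zero_mem _
  · rw [orientedEdge_swap, orientedEdge_of_lt K huv]
    exact neg_mem (Finsupp.single_mem_supported K 1
      ⟨Finset.pair_comm u v ▸ h, Finset.card_pair huv.ne⟩)

/-- The perimeter of an oriented triangle. -/
def orientedTriangle (K : Type u) [Field K] (u v w : V) : Finset V →₀ K :=
  orientedEdge K u v + orientedEdge K v w + orientedEdge K w u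

theorem orientedTriangle_rotate (K : Type u) [Field K] (u v w : V) :
    orientedTriangle K v w u = orientedTriangle K u v w := by
  unfold orientedTriangle
  abel

theorem orientedTriangle_swap (K : Type u) [Field K] (u v w : V) :
    orientedTriangle K v u w = -orientedTriangle K u v w := by
  unfold orientedTriangle
  rw [orientedEdge_swap K u v, orientedEdge_swap K w u, orientedEdge_swap K v w]
  abel

theorem orientedTriangle_of_lt (K : Type u) [Field K] {a b c : V} (hab : a < b) (hbc : b < c) :
    orientedTriangle K a b c = boundary K (Finsupp.single {a, b, c} 1) := by
  rw [boundary_single_triple K hab hbc, orientedTriangle, orientedEdge_swap K a c,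
    orientedEdge_of_lt K hab, orientedEdge_of_lt K hbc, orientedEdge_of_lt K (hab.trans hbc)]
  abel

/-- The perimeter is alternating and vanishes when two vertices coincide, so only increasing
vertices matter, where it is the boundary of a simplex. Allowing any order and repetitions spares
later arguments a case split where the cycle passes from `n - 1` to `0`. -/
theorem orientedTriangle_mem_boundaries {K : Type u} [Field K]
    {X : PreAbstractSimplicialComplex V} {u v w : V} (h : {u, v, w} ∈ X) :
    orientedTriangle K u v w ∈ boundaries K X 1 := by
  have key : ∀ a b c : V, a < b → b < c → ({a, b, c} : Finset V) = {u, v, w} →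
      orientedTriangle K a b c ∈ boundaries K X 1 := by
    intro a b c hab hbc habc
    rw [orientedTriangle_of_lt K hab hbc]
    refine Submodule.mem_map_of_mem (Finsupp.single_mem_supported K 1 ⟨habc ▸ h, ?_⟩)
    exact Finset.card_eq_three.mpr ⟨a, b, c, hab.ne, (hab.trans hbc).ne, hbc.ne, rfl⟩
  have hswap : ∀ a b c : V, orientedTriangle K a b c ∈ boundaries K X 1 →
      orientedTriangle K b a c ∈ boundaries K X 1 := fun a b c h' => by
    rw [orientedTriangle_swap]
    exact neg_mem h'
  have hrot : ∀ a b c : V, orientedTriangle K a b c ∈ boundaries K X 1 →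
      orientedTriangle K b c a ∈ boundaries K X 1 := fun a b c h' => by
    rwa [orientedTriangle_rotate]
  have hdeg : ∀ a b : V, orientedTriangle K a a b = 0 := by
    intro a b
    rw [orientedTriangle, orientedEdge_self, orientedEdge_swap K a b]
    abel
  rcases lt_trichotomy u v with huv | rfl | huv
  · rcases lt_trichotomy v w with hvw | rfl | hvw
    · exact key u v w huv hvw rfl
    · rw [← orientedTriangle_rotate, hdeg]
      exact zero_mem _
    · rcases lt_trichotomy u w with huw | rfl | huw
      · exact hswap _ _ _ (hrot _ _ _ (hrot _ _ _ (key u w v huw hvw (by grind))))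
      · rw [← orientedTriangle_rotate, ← orientedTriangle_rotate, hdeg]
        exact zero_mem _
      · exact hrot _ _ _ (key w u v huw huv (by grind))
  · rw [hdeg]
    exact zero_mem _
  · rcases lt_trichotomy u w with huw | rfl | huw
    · exact hswap _ _ _ (key v u w huv huw (by grind))
    · rw [← orientedTriangle_rotate, ← orientedTriangle_rotate, hdeg]
      exact zero_mem _
    · rcases lt_trichotomy v w with hvw | rfl | hvw
      · exact hrot _ _ _ (hrot _ _ _ (key v w u hvw huw (by grind)))
      · rw [← orientedTriangle_rotate, hdeg]
        exact zero_mem _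
      · exact hswap _ _ _ (hrot _ _ _ (key w v u hvw huv (by grind)))

theorem orientedEdge_add_sub_mem_boundaries {K : Type u} [Field K]
    {X : PreAbstractSimplicialComplex V} {u v w : V} (h : {u, v, w} ∈ X) :
    orientedEdge K u w - (orientedEdge K u v + orientedEdge K v w) ∈ boundaries K X 1 := by
  have := neg_mem (orientedTriangle_mem_boundaries (K := K) h)
  rw [orientedTriangle, orientedEdge_swap K u w] at this
  convert this using 1
  abel

/-- The `1`-boundaries are spanned by the boundaries of triangles. -/
theorem boundaries_one_le_iff {K : Type u} [Field K] {X : PreAbstractSimplicialComplex V}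
    {S : Submodule K (Finset V →₀ K)} :
    boundaries K X 1 ≤ S ↔ ∀ a b c : V, a < b → b < c → {a, b, c} ∈ X →
      boundary K (Finsupp.single {a, b, c} 1) ∈ S := by
  constructor
  · intro h a b c hab hbc hX
    refine h (Submodule.mem_map_of_mem (Finsupp.single_mem_supported K 1 ⟨hX, ?_⟩))
    exact Finset.card_eq_three.mpr ⟨a, b, c, hab.ne, (hab.trans hbc).ne, hbc.ne, rfl⟩
  · intro h
    rw [boundaries, chains, Finsupp.supported_eq_span_single, Submodule.map_span,
      Submodule.span_le]
    rintro _ ⟨_, ⟨σ, ⟨hσX, hσ⟩, rfl⟩, rfl⟩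
    let g := σ.orderEmbOfFin hσ
    have hg : σ = {g 0, g 1, g 2} := by
      ext x
      rw [← Finset.mem_coe, ← Finset.range_orderEmbOfFin σ hσ]
      constructor
      · rintro ⟨i, rfl⟩
        fin_cases i <;> simp [g]
      · intro hx
        simp only [Finset.mem_insert, Finset.mem_singleton] at hx
        rcases hx with rfl | rfl | rfl <;> exact ⟨_, rfl⟩
    rw [hg] at hσX ⊢
    exact h _ _ _ (g.lt_iff_lt.mpr (by decide)) (g.lt_iff_lt.mpr (by decide)) hσX

theorem boundary_eq_zero_of_mem_boundaries {K : Type u} [Field K]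
    {X : PreAbstractSimplicialComplex V} {c : Finset V →₀ K} (hc : c ∈ boundaries K X 1) :
    boundary K c = 0 := by
  suffices h : boundaries K X 1 ≤ LinearMap.ker (boundary K) from h hc
  refine boundaries_one_le_iff.mpr fun a b c hab hbc _ => ?_
  rw [LinearMap.mem_ker, boundary_single_triple K hab hbc]
  simp only [map_add, map_sub, boundary_single_pair K hab, boundary_single_pair K hbc,
    boundary_single_pair K (hab.trans hbc)]
  abel

end OrientedEdges

/-! ### First homology of the arc complexes -/

section Arcs

open scoped Fin.CommRing

variable {n : ℕ} [NeZero n]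

/-- `X` consists of the nonempty sets of vertices of the `n`-cycle that lie on an arc of
length `r`. -/
def IsArcComplex (X : PreAbstractSimplicialComplex (Fin n)) (r : ℕ) : Prop :=
  ∀ σ, σ ∈ X ↔ σ.Nonempty ∧ ∃ x : Fin n, ∀ v ∈ σ, ∃ d : ℕ, d ≤ r ∧ v = x + (d : Fin n)

/-- The edge from `x` to the next vertex of the cycle. -/
def stepEdge (K : Type u) [Field K] (x : Fin n) : Finset (Fin n) →₀ K :=
  orientedEdge K x (x + 1)

/-- The fundamental cycle. -/
def fundamentalCycle (K : Type u) [Field K] (n : ℕ) [NeZero n] : Finset (Fin n) →₀ K :=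
  ∑ x : Fin n, stepEdge K x

theorem boundary_stepEdge (K : Type u) [Field K] (x : Fin n) :
    boundary K (stepEdge K x) = Finsupp.single {x + 1} 1 - Finsupp.single {x} 1 :=
  boundary_orientedEdge K _ _

theorem fundamentalCycle_mem_cycles {K : Type u} [Field K]
    {X : PreAbstractSimplicialComplex (Fin n)} {r : ℕ} (hX : IsArcComplex X r) (hr : 1 ≤ r) :
    fundamentalCycle K n ∈ cycles K X 1 := by
  refine ⟨sum_mem fun x _ => orientedEdge_mem_chains ?_, ?_⟩
  · refine (hX _).mpr ⟨by simp, x, fun v hv => ?_⟩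
    rcases Finset.mem_insert.mp hv with rfl | hv
    · exact ⟨0, by omega, by simp⟩
    · exact ⟨1, hr, by simpa using hv⟩
  · change boundary K (∑ x : Fin n, stepEdge K x) = 0
    rw [map_sum]
    simp only [boundary_stepEdge, Finset.sum_sub_distrib]
    rw [sub_eq_zero]
    -- Adding `1` permutes the vertices, so the ends and the starts of the step edges cancel.
    exact Equiv.sum_comp (Equiv.addRight (1 : Fin n))
      fun x => (Finsupp.single {x} 1 : Finset (Fin n) →₀ K)

/-- A short edge is homologous to the path along the cycle with the same ends. -/
theorem orientedEdge_sub_path_mem_boundaries {K : Type u} [Field K]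
    {X : PreAbstractSimplicialComplex (Fin n)} {r : ℕ} (hX : IsArcComplex X r) (x : Fin n) {d : ℕ}
    (hd : d ≤ r) : orientedEdge K x (x + (d : Fin n)) -
      ∑ i ∈ Finset.range d, stepEdge K (x + (i : Fin n)) ∈ boundaries K X 1 := by
  induction d with
  | zero => simp [orientedEdge_self]
  | succ d ih =>
    -- This triangle lies on the arc from `x` and trades the longer chord for the shorter one and
    -- one step.
    have h : ({x, x + (d : Fin n), x + ((d + 1 : ℕ) : Fin n)} : Finset (Fin n)) ∈ X := by
      refine (hX _).mpr ⟨by simp, x, fun v hv => ?_⟩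
      simp only [Finset.mem_insert, Finset.mem_singleton] at hv
      rcases hv with rfl | rfl | rfl
      · exact ⟨0, by omega, by simp⟩
      · exact ⟨d, by omega, rfl⟩
      · exact ⟨d + 1, hd, rfl⟩
    have hsum := add_mem (orientedEdge_add_sub_mem_boundaries (K := K) h) (ih (by omega))
    rw [Finset.sum_range_succ, stepEdge, add_assoc x (d : Fin n) 1, ← Nat.cast_succ]
    convert hsum using 1
    abel

theorem orientedEdge_mem_span_sup_boundaries {K : Type u} [Field K]
    {X : PreAbstractSimplicialComplex (Fin n)} {r : ℕ} (hX : IsArcComplex X r) (x : Fin n) {d : ℕ}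
    (hd : d ≤ r) : orientedEdge K x (x + (d : Fin n)) ∈
      Submodule.span K (Set.range (stepEdge K (n := n))) ⊔ boundaries K X 1 := by
  have h := orientedEdge_sub_path_mem_boundaries (K := K) hX x hd
  rw [← add_sub_cancel (∑ i ∈ Finset.range d, stepEdge K (x + (i : Fin n)))
    (orientedEdge K x (x + (d : Fin n)))]
  exact Submodule.add_mem_sup
    (sum_mem fun i _ => Submodule.subset_span (Set.mem_range_self _)) h

/-- Two vertices at positions `d` and `e` of an arc are `|d - e| ≤ r` steps apart, so their edge can
be pushed onto the cycle, up to sign. -/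
theorem chains_one_le_span_sup_boundaries {K : Type u} [Field K]
    {X : PreAbstractSimplicialComplex (Fin n)} {r : ℕ} (hX : IsArcComplex X r) :
    chains K X 1 ≤ Submodule.span K (Set.range (stepEdge K (n := n))) ⊔ boundaries K X 1 := by
  rw [chains, Finsupp.supported_eq_span_single, Submodule.span_le]
  rintro _ ⟨σ, ⟨hσX, hσ⟩, rfl⟩
  obtain ⟨a, b, hab, rfl⟩ : ∃ a b, a < b ∧ σ = {a, b} := by
    obtain ⟨a, b, hab, rfl⟩ := Finset.card_eq_two.mp hσ
    rcases lt_or_gt_of_ne hab with h | h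
    · exact ⟨a, b, h, rfl⟩
    · exact ⟨b, a, h, Finset.pair_comm _ _⟩
  obtain ⟨-, x, hx⟩ := (hX _).mp hσX
  obtain ⟨d, hd, ha⟩ := hx a (by simp)
  obtain ⟨e, he, hb⟩ := hx b (by simp)
  change Finsupp.single ({a, b} : Finset (Fin n)) (1 : K) ∈ _
  rw [← orientedEdge_of_lt K hab]
  rcases le_total d e with hde | hde
  · have h : b = a + ((e - d : ℕ) : Fin n) := by
      rw [ha, hb, Nat.cast_sub hde]
      ring
    rw [h]
    exact orientedEdge_mem_span_sup_boundaries hX a (by omega)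
  · have h : a = b + ((d - e : ℕ) : Fin n) := by
      rw [ha, hb, Nat.cast_sub hde]
      ring
    rw [orientedEdge_swap, h]
    exact neg_mem (orientedEdge_mem_span_sup_boundaries hX b (by omega))

/-- Every cycle is homologous to a multiple of the fundamental cycle. -/
theorem exists_sub_smul_fundamentalCycle_mem_boundaries {K : Type u} [Field K]
    {X : PreAbstractSimplicialComplex (Fin n)} {r : ℕ} (hX : IsArcComplex X r)
    {c : Finset (Fin n) →₀ K} (hc : c ∈ cycles K X 1) :
    ∃ a : K, c - a • fundamentalCycle K n ∈ boundaries K X 1 := by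
  obtain ⟨p, hp, b, hb, rfl⟩ := Submodule.mem_sup.mp (chains_one_le_span_sup_boundaries hX hc.1)
  obtain ⟨a, rfl⟩ := (Submodule.mem_span_range_iff_exists_fun K).mp hp
  have h0 : boundary K (∑ x, a x • stepEdge K x) = 0 := by
    have h := LinearMap.mem_ker.mp hc.2
    rwa [map_add, boundary_eq_zero_of_mem_boundaries hb, add_zero] at h
  have hstep : ∀ y : Fin n, a (y + 1) = a y := by
    intro y
    -- The coefficient of the boundary at the vertex `y + 1` is `a y - a (y + 1)`.
    have h := DFunLike.congr_fun h0 {y + 1}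
    simp only [map_sum, map_smul, boundary_stepEdge, Finsupp.finsetSum_apply, Finsupp.smul_apply,
      Finsupp.sub_apply, Finsupp.single_apply, Finset.singleton_inj, add_left_inj,
      smul_eq_mul, mul_sub, Finset.sum_sub_distrib, mul_ite, mul_one, mul_zero,
      Finset.sum_ite_eq', Finset.mem_univ, if_true, Finsupp.coe_zero, Pi.zero_apply] at h
    exact (sub_eq_zero.mp h).symm
  have hconst : ∀ k : ℕ, a (k : Fin n) = a 0 := by
    intro k
    induction k with
    | zero => simp
    | succ k ih => rw [Nat.cast_succ, hstep, ih]
  refine ⟨a 0, ?_⟩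
  have : ∑ x, a x • stepEdge K x = a 0 • fundamentalCycle K n := by
    rw [fundamentalCycle, Finset.smul_sum]
    refine Finset.sum_congr rfl fun x _ => ?_
    rw [← hconst x, Fin.cast_val_eq_self]
  rw [this, add_sub_cancel_left]
  exact hb

/-- If arcs reach half way round, the fundamental cycle is a boundary. -/
theorem fundamentalCycle_mem_boundaries {K : Type u} [Field K]
    {X : PreAbstractSimplicialComplex (Fin n)} {r : ℕ} (hX : IsArcComplex X r) (hr : n ≤ 2 * r) :
    fundamentalCycle K n ∈ boundaries K X 1 := by
  -- The cycle is cut at `0` and `n / 2`. Both paths have at most `r` steps, so they are homologous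
  -- to the same chord in opposite directions.
  have hsum : fundamentalCycle K n =
      ∑ i ∈ Finset.range (n / 2), stepEdge K (0 + (i : Fin n)) +
      ∑ i ∈ Finset.range (n - n / 2),
        stepEdge K (((n / 2 : ℕ) : Fin n) + (i : Fin n)) := by
    have h1 := Finset.sum_range_add (fun i : ℕ => stepEdge K (i : Fin n)) (n / 2) (n - n / 2)
    rw [show n / 2 + (n - n / 2) = n by omega, Finset.sum_range] at h1
    simpa [fundamentalCycle] using h1
  have h1 := orientedEdge_sub_path_mem_boundaries (K := K) hX 0 (d := n / 2) (by omega)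
  have h2 := orientedEdge_sub_path_mem_boundaries (K := K) hX ((n / 2 : ℕ) : Fin n)
    (d := n - n / 2) (by omega)
  have h3 : ((n / 2 : ℕ) : Fin n) + ((n - n / 2 : ℕ) : Fin n) = 0 := by
    rw [← Nat.cast_add, show n / 2 + (n - n / 2) = n by omega]
    simp
  rw [h3, orientedEdge_swap K 0] at h2
  rw [zero_add] at h1
  rw [hsum]
  convert neg_mem (add_mem h1 h2) using 1
  abel

/-! ### Nontriviality of the fundamental cycle -/

/-- The cochain that counts the edges crossing from `n - 1` to `0`. -/
def winding (K : Type u) [Field K] (n : ℕ) : (Finset (Fin n) →₀ K) →ₗ[K] K :=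
  open Classical in
  Finsupp.linearCombination K fun σ => if ∃ u ∈ σ, ∃ v ∈ σ, n < 2 * ((v : ℕ) - u) then 1 else 0

omit [NeZero n] in
-- Natural subtraction truncates, so only the gap `b - a` counts. A gap above `n / 2` means that the
-- short way between the vertices passes between `n - 1` and `0`; the increasing orientation crosses
-- there backwards.
theorem winding_pair (K : Type u) [Field K] {a b : Fin n} (hab : a < b) :
    winding K n (Finsupp.single {a, b} 1) = if n < 2 * ((b : ℕ) - a) then 1 else 0 := by
  rw [winding, Finsupp.linearCombination_single, one_smul]
  refine if_congr ⟨?_, fun h => ⟨a, by simp, b, by simp, h⟩⟩ rfl rfl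
  have hab' : (a : ℕ) < b := hab
  rintro ⟨u, hu, v, hv, h⟩
  simp only [Finset.mem_insert, Finset.mem_singleton] at hu hv
  rcases hu with rfl | rfl <;> rcases hv with rfl | rfl <;> omega

theorem val_add_natCast {x : Fin n} {d : ℕ} (hd : d < n) :
    ((x + (d : Fin n) : Fin n) : ℕ) = x + d ∨ ((x + (d : Fin n) : Fin n) : ℕ) + n = x + d := by
  have hx := x.isLt
  rw [Fin.val_add, Fin.val_natCast, Nat.mod_eq_of_lt hd]
  rcases lt_or_ge ((x : ℕ) + d) n with h | h
  · exact Or.inl (Nat.mod_eq_of_lt h)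
  · right
    rw [Nat.mod_eq_sub_mod h, Nat.mod_eq_of_lt (by omega)]
    omega

/-- On an arc shorter than half the cycle, two vertices have a gap above `n / 2` exactly when the
passage from `n - 1` to `0` separates them. It separates either no pair of a triangle, or the pair
`{a, c}` and one of the others, and then the signs cancel. -/
theorem winding_eq_zero_of_mem_boundaries {K : Type u} [Field K]
    {X : PreAbstractSimplicialComplex (Fin n)} {r : ℕ} (hX : IsArcComplex X r) (hr : 2 * r < n)
    {c : Finset (Fin n) →₀ K} (hc : c ∈ boundaries K X 1) : winding K n c = 0 := by
  suffices h : boundaries K X 1 ≤ LinearMap.ker (winding K n) from h hc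
  refine boundaries_one_le_iff.mpr fun a b c hab hbc habc => ?_
  obtain ⟨-, x, hx⟩ := (hX _).mp habc
  obtain ⟨i, hi, ha⟩ := hx a (by simp)
  obtain ⟨j, hj, hb⟩ := hx b (by simp)
  obtain ⟨k, hk, hc⟩ := hx c (by simp)
  have ha' := val_add_natCast (x := x) (show i < n by omega)
  have hb' := val_add_natCast (x := x) (show j < n by omega)
  have hc' := val_add_natCast (x := x) (show k < n by omega)
  rw [← ha] at ha'
  rw [← hb] at hb'
  rw [← hc] at hc'
  have h1 : (a : ℕ) < b := hab
  have h2 : (b : ℕ) < c := hbc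
  have h3 := c.isLt
  have h4 := x.isLt
  rw [LinearMap.mem_ker, boundary_single_triple K hab hbc, map_add, map_sub, winding_pair K hab,
    winding_pair K hbc, winding_pair K (hab.trans hbc)]
  split_ifs <;> first | (exfalso; omega) | simp

/-- Only the step from `n - 1` to `0` counts, with a minus sign because its simplex is oriented from
`0` to `n - 1`. The other steps have gap `1`, too small as `n ≥ 3`. -/
theorem winding_fundamentalCycle (K : Type u) [Field K] (hn : 3 ≤ n) :
    winding K n (fundamentalCycle K n) = -1 := by
  have hlast : ((n - 1 : ℕ) : Fin n) + 1 = 0 := by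
    rw [← Nat.cast_succ, show (n - 1).succ = n by omega]
    simp
  have hval : (((n - 1 : ℕ) : Fin n) : ℕ) = n - 1 := by
    rw [Fin.val_natCast, Nat.mod_eq_of_lt (by omega)]
  rw [fundamentalCycle, map_sum, Finset.sum_eq_single ((n - 1 : ℕ) : Fin n)]
  · have hlt : (0 : Fin n) < ((n - 1 : ℕ) : Fin n) := by
      rw [Fin.lt_def, hval, Fin.val_zero]
      omega
    rw [stepEdge, hlast, orientedEdge_swap, orientedEdge_of_lt K hlt, map_neg,
      winding_pair K hlt, if_pos]
    rw [hval, Fin.val_zero]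
    omega
  · intro x _ hx
    have hxlt := x.isLt
    have hx1 : (x : ℕ) ≠ n - 1 := fun h => hx (Fin.ext (h.trans hval.symm))
    have hval1 : ((x + 1 : Fin n) : ℕ) = x + 1 := by
      have := val_add_natCast (x := x) (show 1 < n by omega)
      rw [Nat.cast_one] at this
      generalize ((x + 1 : Fin n) : ℕ) = y at this ⊢
      omega
    have hlt : x < x + 1 := by
      rw [Fin.lt_def, hval1]
      omega
    rw [stepEdge, orientedEdge_of_lt K hlt, winding_pair K hlt, if_neg]
    rw [hval1]
    omega
  · simp

theorem isArcComplex_dowkerSource (hn : 3 ≤ n) {δ : ℝ} (hδ : 0 ≤ δ) :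
    IsArcComplex (dowkerSource (cycleNetwork n hn) δ) ⌊δ⌋₊ :=
  mem_dowkerSource_iff_floor hn hδ

/-- Outside `[1, ⌈n / 2⌉)` the first homology vanishes. -/
theorem cycles_le_boundaries_dowkerSource {K : Type u} [Field K] (hn : 3 ≤ n) {δ : ℝ}
    (hδ : ¬ (1 ≤ δ ∧ δ < (⌈(n : ℝ) / 2⌉ : ℝ))) :
    cycles K (dowkerSource (cycleNetwork n hn) δ) 1 ≤
      boundaries K (dowkerSource (cycleNetwork n hn) δ) 1 := by
  rcases lt_or_ge δ 0 with h0 | h0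
  · rw [cycles_eq_bot fun σ hσ => (notMem_dowkerSource_of_neg _ h0 σ hσ).elim]
    exact bot_le
  have hX := isArcComplex_dowkerSource hn h0
  rcases lt_or_ge δ 1 with h1 | h1
  · rw [cycles_eq_bot]
    · exact bot_le
    · intro σ hσ hcard
      obtain ⟨-, x, hx⟩ := (hX σ).mp hσ
      have hsub : σ ⊆ {x} := by
        intro v hv
        obtain ⟨d, hd, rfl⟩ := hx v hv
        rw [Nat.floor_eq_zero.mpr h1, Nat.le_zero] at hd
        simp [hd]
      have := Finset.card_le_card hsub
      rw [Finset.card_singleton] at this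
      omega
  · have hr : n ≤ 2 * ⌊δ⌋₊ := by
      have h2 : (⌈(n : ℝ) / 2⌉ : ℝ) ≤ δ := not_lt.mp fun h => hδ ⟨h1, h⟩
      have h3 : ⌈(n : ℝ) / 2⌉ ≤ ⌊δ⌋ := Int.le_floor.mpr h2
      have h4 : (n : ℝ) / 2 ≤ (⌊δ⌋ : ℝ) := Int.ceil_le.mp h3
      rw [← natCast_floor_eq_intCast_floor h0] at h4
      have h5 : (n : ℝ) ≤ 2 * (⌊δ⌋₊ : ℝ) := by linarith
      exact_mod_cast h5
    intro c hc
    obtain ⟨a, ha⟩ := exists_sub_smul_fundamentalCycle_mem_boundaries hX hc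
    rw [← sub_add_cancel c (a • fundamentalCycle K n)]
    exact add_mem ha (Submodule.smul_mem _ a (fundamentalCycle_mem_boundaries hX hr))

omit [NeZero n] in
theorem two_mul_floor_lt {δ : ℝ} (h0 : 0 ≤ δ) (hδ : δ < (⌈(n : ℝ) / 2⌉ : ℝ)) :
    2 * ⌊δ⌋₊ < n := by
  have h3 : ⌊δ⌋ < ⌈(n : ℝ) / 2⌉ := Int.floor_lt.mpr hδ
  have h4 : (⌊δ⌋ : ℝ) < (n : ℝ) / 2 := Int.lt_ceil.mp h3
  rw [← natCast_floor_eq_intCast_floor h0] at h4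
  have h5 : 2 * (⌊δ⌋₊ : ℝ) < (n : ℝ) := by linarith
  exact_mod_cast h5

end Arcs

/-! ### The first persistence diagram -/

/-- The homology class of a cycle. -/
def homologyClass {K : Type u} [Field K] {V : Type} [LinearOrder V]
    {X : PreAbstractSimplicialComplex V} {k : ℕ} (c : cycles K X k) : homology K X k :=
  Submodule.mkQ _ c

theorem homologyClass_surjective {K : Type u} [Field K] {V : Type} [LinearOrder V]
    {X : PreAbstractSimplicialComplex V} {k : ℕ} :
    Function.Surjective (homologyClass : cycles K X k → homology K X k) :=
  Submodule.mkQ_surjective _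

theorem smul_homologyClass_eq_iff {K : Type u} [Field K] {V : Type} [LinearOrder V]
    {X : PreAbstractSimplicialComplex V} {k : ℕ} (a : K) (c c' : cycles K X k) :
    a • homologyClass c = homologyClass c' ↔
      (c' : Finset V →₀ K) - a • (c : Finset V →₀ K) ∈ boundaries K X k := by
  rw [homologyClass, homologyClass, ← map_smul, eq_comm, ← sub_eq_zero, ← map_sub,
    Submodule.mkQ_apply, Submodule.Quotient.mk_eq_zero]
  rfl

theorem homologyMap_homologyClass {K : Type u} [Field K] {V : Type} [LinearOrder V]
    {X Y : PreAbstractSimplicialComplex V} (h : X ≤ Y) {k : ℕ} (c : cycles K X k) :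
    homologyMap K h k (homologyClass c) = homologyClass ⟨c, cycles_mono h k c.2⟩ :=
  rfl

/-- The bar `[1, ⌈n / 2⌉)`. -/
def cycleBar (n : ℕ) (hn : 3 ≤ n) : Bar where
  birth := 1
  death := ((⌈(n : ℝ) / 2⌉ : ℝ) : WithTop ℝ)
  carrier := {t | 1 ≤ t ∧ t < (⌈(n : ℝ) / 2⌉ : ℝ)}
  nonempty := ⟨1, le_rfl, by
    have h : (3 : ℝ) ≤ n := by exact_mod_cast hn
    exact lt_of_lt_of_le (by linarith) (Int.le_ceil ((n : ℝ) / 2))⟩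
  mem_of_lt _ h1 h2 := ⟨h1.le, WithTop.coe_lt_coe.mp h2⟩
  birth_le _ h := h.1
  le_death _ h := WithTop.coe_le_coe.mpr h.2.le

/-- The first persistent homology of a cycle network is the interval module of
`[1, ⌈n / 2⌉)`, generated by the class of the fundamental cycle. -/
theorem decomposesAs_dowkerSource_one {n : ℕ} (hn : 3 ≤ n) (K : Type u) [Field K] :
    DecomposesAs (persistentHomology K (dowkerSource (cycleNetwork n hn)) 1)
      {((1 : ℝ), ((⌈(n : ℝ) / 2⌉ : ℝ) : WithTop ℝ))} := by
  classical
  have : NeZero n := ⟨by omega⟩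
  let F := dowkerSource (cycleNetwork n hn)
  have hcyc : ∀ t ∈ (cycleBar n hn).carrier, fundamentalCycle K n ∈ cycles K (F t) 1 :=
    fun t ht => fundamentalCycle_mem_cycles
      (isArcComplex_dowkerSource hn (zero_le_one.trans ht.1)) (Nat.le_floor (by simpa using ht.1))
  have hsub : ∀ t, t ∉ (cycleBar n hn).carrier → Subsingleton (homology K (F t) 1) :=
    fun t ht => homology_subsingleton_of_cycles_le (cycles_le_boundaries_dowkerSource hn ht)
  let v : ∀ t, homology K (F t) 1 := fun t =>
    if h : t ∈ (cycleBar n hn).carrier then homologyClass ⟨_, hcyc t h⟩ else 0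
  have hv : ∀ t (h : t ∈ (cycleBar n hn).carrier),
      v t = homologyClass ⟨_, hcyc t h⟩ := fun t h => dif_pos h
  have hv' : ∀ t, t ∉ (cycleBar n hn).carrier → v t = 0 := fun t h => dif_neg h
  have hmap : ∀ s t (h : s ≤ t), s ∈ (cycleBar n hn).carrier →
      homologyMap K (F.monotone h) 1 (v s) = v t := by
    intro s t h hs
    by_cases ht : t ∈ (cycleBar n hn).carrier
    · rw [hv s hs, hv t ht, homologyMap_homologyClass]
    · have := hsub t ht
      exact Subsingleton.elim _ _
  have hspan : ∀ t (x : homology K (F t) 1), ∃ a : K, a • v t = x := by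
    intro t x
    by_cases ht : t ∈ (cycleBar n hn).carrier
    · obtain ⟨c, rfl⟩ := homologyClass_surjective x
      obtain ⟨a, ha⟩ := exists_sub_smul_fundamentalCycle_mem_boundaries
        (isArcComplex_dowkerSource hn (zero_le_one.trans ht.1)) c.2
      refine ⟨a, ?_⟩
      rw [hv t ht]
      exact (smul_homologyClass_eq_iff _ _ _).mpr ha
    · have := hsub t ht
      exact ⟨0, Subsingleton.elim _ _⟩
  have hinj : ∀ t (a : K), t ∈ (cycleBar n hn).carrier → a • v t = 0 → a = 0 := by
    intro t a ht ha
    have hzero : (homologyClass 0 : homology K (F t) 1) = 0 := map_zero _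
    rw [hv t ht, ← hzero, smul_homologyClass_eq_iff, Submodule.coe_zero, zero_sub] at ha
    have h0 : (0 : ℝ) ≤ t := zero_le_one.trans ht.1
    -- Here `-a` times the fundamental cycle is a boundary, so its winding `a` is zero.
    have h := winding_eq_zero_of_mem_boundaries (isArcComplex_dowkerSource hn h0)
      (two_mul_floor_lt h0 ht.2) ha
    rw [map_neg, map_smul, winding_fundamentalCycle K hn] at h
    simpa using h
  refine decomposesAs_of_generators (persistentHomology K F 1) (m := 1) (fun _ => cycleBar n hn)
    (fun _ => v) (fun _ => hv') (fun _ => hmap) (fun t x => ?_) fun t c hc hsum l => ?_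
  · obtain ⟨a, ha⟩ := hspan t x
    exact ⟨fun _ => a, by rw [Fin.sum_univ_one]; exact ha⟩
  · rw [Fin.sum_univ_one] at hsum
    obtain rfl : l = 0 := Subsingleton.elim _ _
    by_cases ht : t ∈ (cycleBar n hn).carrier
    · exact hinj t _ ht hsum
    · exact hc 0 ht

end

end WalkPersistence

theorem mainTheorem4 (n : ℕ) (hn : 3 ≤ n) (K : Type u) [Field K] :
    (∀ δ : ℝ, WalkPersistence.dowkerSink (WalkPersistence.cycleNetwork n hn) δ =
      WalkPersistence.walkLength (WalkPersistence.cycleNetwork n hn).toWeightedDigraph δ) ∧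
    (∀ k : ℕ, ∃ D : Multiset (ℝ × WithTop ℝ),
      WalkPersistence.IsPersistenceDiagram (WalkPersistence.persistentHomology K
        (WalkPersistence.dowkerSink (WalkPersistence.cycleNetwork n hn)) k) D ∧
      WalkPersistence.IsPersistenceDiagram (WalkPersistence.persistentHomology K
        (WalkPersistence.dowkerSource (WalkPersistence.cycleNetwork n hn)) k) D ∧
      WalkPersistence.IsPersistenceDiagram (WalkPersistence.persistentHomology K
        (WalkPersistence.walkLength
          (WalkPersistence.cycleNetwork n hn).toWeightedDigraph) k) D) ∧
    WalkPersistence.IsPersistenceDiagram (WalkPersistence.persistentHomology K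
      (WalkPersistence.walkLength (WalkPersistence.cycleNetwork n hn).toWeightedDigraph) 1)
      {((1 : ℝ), ((⌈(n : ℝ) / 2⌉ : ℝ) : WithTop ℝ))} := by
  -- All three filtrations become the source filtration, so one diagram serves for each of them.
  rw [WalkPersistence.dowkerSink_eq_dowkerSource, WalkPersistence.walkLength_eq_dowkerSource]
  refine ⟨fun _ => rfl, fun k => ?_,
    (WalkPersistence.decomposesAs_dowkerSource_one hn K).isPersistenceDiagram⟩
  obtain ⟨D, hD⟩ := WalkPersistence.exists_decomposesAs_dowkerSource hn K k
  exact ⟨D, hD.isPersistenceDiagram, hD.isPersistenceDiagram, hD.isPersistenceDiagram⟩
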